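/- Let $\nu$ be a probability measure on $[-\pi,\pi]$ with a continuous (hence bounded) density $p$ with respect to Lebesgue measure. For $N,L\ge 1$ let $\theta_1,\dots,\theta_L$ be i.i.d. with law $\nu$, and let ${\bf V}$ be the $N\times L$ random Vandermonde matrix with entries ${\bf V}_{k,a}=N^{-1/2}e^{-ik\theta_a}$, $0\le k\le N-1$, $1\le a\le L$. Let $\lambda_1,\dots,\lambda_L$ be the eigenvalues of ${\bf V}^*{\bf V}$, let $\mathrm{tr}_L=L^{-1}\mathrm{Tr}$, and let $\mu_L$ be the averaged empirical eigenvalue distribution of ${\bf V}^*{\bf V}$, i.e. $\mu_L(S)=\mathbb{E}\big[L^{-1}\#\{i:\lambda_i\in S\}\big]$. For $n\ge 1$ let $\mathcal{P}(n)$ be the set of partitions of $\{1,\dots,n\}$. For $\rho\in\mathcal{P}(n)$ with $|\rho|$ blocks put $$K_{\rho,\nu,N}=\frac{N^{|\rho|}}{N^{n+1}}\sum_{i_1,\dots,i_n=0}^{N-1}\ \prod_{B\in\rho}\int_{-\pi}^{\pi}e^{iE_Bx}\,d\nu(x),\qquad E_B=\sum_{k\in B}(i_{k-1}-i_k),\quad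 i_0:=i_n .$$ Theorem. (a) For all $n\ge1$ and $\rho\in\mathcal{P}(n)$ the limit $K_{\rho,\nu}=\lim_{N\to\infty}K_{\rho,\nu,N}$ exists and is real. (b) For $c\ge 0$ and $n\ge 1$ put $m^{(c)}_{\nu,n}=\sum_{\rho\in\mathcal{P}(n)}K_{\rho,\nu}\,c^{|\rho|-1}$ (with $0^0=1$). For every $c\ge 0$ there is a unique probability measure $\mu_c$ on $[0,\infty)$ all of whose moments are finite and satisfy $$\int_0^\infty t^n\,d\mu_c(t)=m^{(c)}_{\nu,n}\qquad\text{for all } n\ge 1 .$$ Moreover, whenever $N\to\infty$ with $L\ge1$ and $L/N\to c$, one has $\mathbb{E}\big[\mathrm{tr}_L\big(({\bf V}^*{\bf V})^n\big)\big]\to m^{(c)}_{\nu,n}$ for all $n\ge1$, and $\mu_L$ converges weakly to $\mu_c$. -/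

import Mathlib

open MeasureTheory Filter Topology
open scoped Matrix ENNReal NNReal

noncomputable section

namespace RandomVandermonde

/-- The `N × L` Vandermonde matrix with unit-modulus entries (normalised by `1/√N`) and phases
`θ`: the entry in row `k = 0, …, N-1` and column `a` is `N^{-1/2} e^{-i k θ_a}`. -/
def vandermondeMatrix (N L : ℕ) (θ : Fin L → ℝ) : Matrix (Fin N) (Fin L) ℂ :=
  Matrix.of fun k a =>
    (1 / (Real.sqrt N : ℂ)) * Complex.exp (-Complex.I * (k : ℕ) * (θ a : ℂ))

/-- The `L × L` matrix `V* V`. -/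
def gramMatrix (N L : ℕ) (θ : Fin L → ℝ) : Matrix (Fin L) (Fin L) ℂ :=
  (vandermondeMatrix N L θ)ᴴ * vandermondeMatrix N L θ

theorem gramMatrix_isHermitian (N L : ℕ) (θ : Fin L → ℝ) : (gramMatrix N L θ).IsHermitian :=
  Matrix.isHermitian_conjTranspose_mul_self _

/-- The empirical eigenvalue distribution `L⁻¹ ∑ᵢ δ_{λᵢ}` of `V* V`, for given phases, where
`λ₁, …, λ_L` are the eigenvalues with multiplicity. -/
def empiricalMeasure (N L : ℕ) (θ : Fin L → ℝ) : Measure ℝ :=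
  (L : ℝ≥0∞)⁻¹ • ∑ i : Fin L, Measure.dirac ((gramMatrix_isHermitian N L θ).eigenvalues i)

/-- The joint law of `L` independent phases with common law `ν`. -/
def phaseLaw (ν : Measure ℝ) (L : ℕ) : Measure (Fin L → ℝ) :=
  Measure.pi fun _ => ν

/-- The averaged empirical eigenvalue distribution: the mixture of the empirical eigenvalue
distributions over the random phases, that is `S ↦ 𝔼[L⁻¹ #{i : λᵢ ∈ S}]`. -/
def averagedMeasure (ν : Measure ℝ) (N L : ℕ) : Measure ℝ :=
  (phaseLaw ν L).bind (empiricalMeasure N L)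

/-- The expected normalised trace `𝔼[tr_L((V* V)^n)]`, with `tr_L = L⁻¹ Tr`. -/
def expectedMoment (ν : Measure ℝ) (N L n : ℕ) : ℂ :=
  ∫ θ, (1 / (L : ℂ)) * ((gramMatrix N L θ) ^ n).trace ∂(phaseLaw ν L)

/-! ### Expansion coefficients -/

/-- The Fourier coefficient `𝔼[e^{i m θ}]` of the phase law. -/
def phaseFourier (ν : Measure ℝ) (m : ℤ) : ℂ :=
  ∫ x, Complex.exp (Complex.I * (m : ℂ) * (x : ℂ)) ∂ν

/-- For an index vector `i` and a block `B`, the exponent `E_B = ∑_{k ∈ B} (i_{k-1} - i_k)`, the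
index `k - 1` being read cyclically (`finRotate n` is the cyclic successor on `Fin n`). -/
def blockExponent {n N : ℕ} (i : Fin n → Fin N) (B : Finset (Fin n)) : ℤ :=
  ∑ k ∈ B, (((i ((finRotate n).symm k) : ℕ) : ℤ) - ((i k : ℕ) : ℤ))

/-- The prelimit coefficient
`K_{ρ,ν,N} = N^{|ρ|} / N^{n+1} ∑_{i ∈ {0,…,N-1}^n} ∏_{B ∈ ρ} 𝔼[e^{i E_B θ}]`. -/
def expansionCoeffN (ν : Measure ℝ) {n : ℕ} (ρ : Finpartition (Finset.univ : Finset (Fin n)))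
    (N : ℕ) : ℂ :=
  ((N : ℂ) ^ ρ.parts.card / (N : ℂ) ^ (n + 1)) *
    ∑ i : Fin n → Fin N, ∏ B ∈ ρ.parts, phaseFourier ν (blockExponent i B)

/-- The Vandermonde expansion coefficient `K_{ρ,ν} = lim_N K_{ρ,ν,N}`, a real number. (The
existence of the limit is not part of the definition.) -/
def expansionCoeff (ν : Measure ℝ) {n : ℕ}
    (ρ : Finpartition (Finset.univ : Finset (Fin n))) : ℝ :=
  limUnder atTop fun N : ℕ => (expansionCoeffN ν ρ N).re

/-- `m^{(c)}_{ν,n} = ∑_{ρ ∈ P(n)} K_{ρ,ν} c^{|ρ|-1}` (for `n ≥ 1`, so that `|ρ| ≥ 1`). -/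
def limitMoment (ν : Measure ℝ) (c : ℝ) (n : ℕ) : ℝ :=
  ∑ ρ : Finpartition (Finset.univ : Finset (Fin n)),
    expansionCoeff ν ρ * c ^ (ρ.parts.card - 1)

/-! ### The averaged empirical eigenvalue distribution is a probability measure -/

theorem trace_pow_eq_sum {L : ℕ} {A : Matrix (Fin L) (Fin L) ℂ} (hA : A.IsHermitian) (n : ℕ) :
    ((A ^ n).trace).re = ∑ i, hA.eigenvalues i ^ n := by
  have h : A ^ n = Unitary.conjStarAlgAut ℂ _ hA.eigenvectorUnitary
      (Matrix.diagonal (RCLike.ofReal ∘ hA.eigenvalues) ^ n) := by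
    rw [map_pow, ← hA.spectral_theorem]
  rw [h, Unitary.conjStarAlgAut_apply, Matrix.trace_mul_cycle]
  simp only [Unitary.coe_star_mul_self, one_mul, Matrix.diagonal_pow, Matrix.trace_diagonal]
  simp only [Pi.pow_apply, Function.comp_apply, Complex.re_sum]
  refine Finset.sum_congr rfl fun i _ => ?_
  simp [← Complex.ofReal_pow]

theorem continuous_gramMatrix (N L : ℕ) (a b : Fin L) :
    Continuous fun θ : Fin L → ℝ => gramMatrix N L θ a b := by
  unfold gramMatrix vandermondeMatrix
  simp only [Matrix.mul_apply, Matrix.conjTranspose_apply, Matrix.of_apply]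
  fun_prop

theorem measurable_sum_pow (N L n : ℕ) :
    Measurable fun θ : Fin L → ℝ =>
      ∑ i, (gramMatrix_isHermitian N L θ).eigenvalues i ^ n := by
  simp_rw [← trace_pow_eq_sum]
  have h : Continuous fun θ : Fin L → ℝ => gramMatrix N L θ :=
    continuous_matrix fun a b => continuous_gramMatrix N L a b
  exact (Complex.continuous_re.comp (h.pow n).matrix_trace).measurable

theorem measurable_sum_eval (N L : ℕ) (p : Polynomial ℝ) :
    Measurable fun θ : Fin L → ℝ =>
      ∑ i, p.eval ((gramMatrix_isHermitian N L θ).eigenvalues i) := by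
  simp_rw [Polynomial.eval_eq_sum_range]
  simp_rw [Finset.sum_comm (s := (Finset.univ : Finset (Fin L))), ← Finset.mul_sum]
  exact Finset.measurable_fun_sum _ fun n _ => (measurable_sum_pow N L n).const_mul _

theorem measurable_sum_continuous (N L : ℕ) {f : ℝ → ℝ} (hf : Continuous f) :
    Measurable fun θ : Fin L → ℝ =>
      ∑ i, f ((gramMatrix_isHermitian N L θ).eigenvalues i) := by
  have hp : ∀ k : ℕ, ∃ p : Polynomial ℝ, ∀ x ∈ Set.Icc (-(k : ℝ)) k,
      |p.eval x - f x| < 1 / ((k : ℝ) + 1) := fun k =>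
    exists_polynomial_near_of_continuousOn _ _ f hf.continuousOn _ (by positivity)
  choose p hp using hp
  refine measurable_of_tendsto_metrizable (fun k => measurable_sum_eval N L (p k)) ?_
  refine tendsto_pi_nhds.2 fun θ => tendsto_finsetSum _ fun i _ => ?_
  rw [tendsto_iff_dist_tendsto_zero]
  refine squeeze_zero' (Eventually.of_forall fun _ => dist_nonneg) ?_
    tendsto_one_div_add_atTop_nhds_zero_nat
  filter_upwards [(tendsto_natCast_atTop_atTop (R := ℝ)).eventually_ge_atTop
    |(gramMatrix_isHermitian N L θ).eigenvalues i|] with k hk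
  exact (hp k _ (abs_le.1 hk)).le

theorem isProbabilityMeasure_empiricalMeasure (N : ℕ) {L : ℕ} (hL : 0 < L) (θ : Fin L → ℝ) :
    IsProbabilityMeasure (empiricalMeasure N L θ) := by
  constructor
  simp only [empiricalMeasure, Measure.smul_apply, Measure.finsetSum_apply, measure_univ,
    Finset.sum_const, Finset.card_univ, Fintype.card_fin, smul_eq_mul, nsmul_eq_mul, mul_one]
  exact ENNReal.inv_mul_cancel (by exact_mod_cast hL.ne') (ENNReal.natCast_ne_top L)

theorem measurable_empiricalMeasure (N : ℕ) {L : ℕ} (hL : 0 < L) :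
    Measurable (empiricalMeasure N L) := by
  have := isProbabilityMeasure_empiricalMeasure N hL
  refine Measurable.measure_of_isPiSystem_of_isProbabilityMeasure
    (S := {s : Set ℝ | IsClosed s})
    (by rw [← borel_eq_generateFrom_isClosed]; exact BorelSpace.measurable_eq)
    isPiSystem_isClosed fun F hF => ?_
  have hδ : ∀ n : ℕ, (0 : ℝ) < 1 / ((n : ℝ) + 1) := fun n => by positivity
  refine measurable_of_tendsto_metrizable (f := fun (n : ℕ) θ =>
    ∫⁻ x, (thickenedIndicator (hδ n) F x : ℝ≥0∞) ∂(empiricalMeasure N L θ)) (fun n => ?_)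
    (tendsto_pi_nhds.2 fun θ => tendsto_lintegral_thickenedIndicator_of_isClosed _ hF hδ
      tendsto_one_div_add_atTop_nhds_zero_nat)
  have hc : Continuous fun x : ℝ => ((thickenedIndicator (hδ n) F x : ℝ≥0) : ℝ) :=
    NNReal.continuous_coe.comp (thickenedIndicator (hδ n) F).continuous
  have hm : Measurable fun x : ℝ => (thickenedIndicator (hδ n) F x : ℝ≥0∞) :=
    (ENNReal.continuous_coe.comp (thickenedIndicator (hδ n) F).continuous).measurable
  have h := ((measurable_sum_continuous N L hc).ennreal_ofReal).const_mul ((L : ℝ≥0∞)⁻¹)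
  convert h using 2 with θ
  rw [empiricalMeasure, lintegral_smul_measure, lintegral_finsetSum_measure]
  simp only [smul_eq_mul]
  rw [ENNReal.ofReal_sum_of_nonneg fun i _ => NNReal.coe_nonneg _]
  congr 1
  refine Finset.sum_congr rfl fun i _ => ?_
  rw [lintegral_dirac' _ hm, ENNReal.ofReal_coe_nnreal]

theorem isProbabilityMeasure_averagedMeasure (ν : Measure ℝ) [IsProbabilityMeasure ν] (N : ℕ)
    {L : ℕ} (hL : 0 < L) : IsProbabilityMeasure (averagedMeasure ν N L) := by
  have := isProbabilityMeasure_empiricalMeasure N hL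
  have hp : IsProbabilityMeasure (phaseLaw ν L) := by unfold phaseLaw; infer_instance
  constructor
  rw [averagedMeasure, Measure.bind_apply MeasurableSet.univ
    (measurable_empiricalMeasure N hL).aemeasurable]
  simp

/-- The averaged empirical eigenvalue distribution as an element of the space of probability
measures on `ℝ`, which carries the topology of weak convergence. -/
def averagedLaw (ν : Measure ℝ) [IsProbabilityMeasure ν] (N L : ℕ) (hL : 0 < L) :
    ProbabilityMeasure ℝ :=
  ⟨averagedMeasure ν N L, isProbabilityMeasure_averagedMeasure ν N hL⟩

/-- `μ` is carried by `[0, ∞)`, all its moments are finite, and its `n`-th moment equals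
`m^{(c)}_{ν,n}` for every `n ≥ 1`. -/
def HasLimitMoments (ν : Measure ℝ) (c : ℝ) (μ : ProbabilityMeasure ℝ) : Prop :=
  (μ : Measure ℝ) (Set.Iio 0) = 0 ∧
    ∀ n : ℕ, 1 ≤ n → Integrable (fun t : ℝ => t ^ n) (μ : Measure ℝ) ∧
      ∫ t, t ^ n ∂(μ : Measure ℝ) = limitMoment ν c n

end RandomVandermonde

end

/-! In `K_{ρ,ν,N}` take the variable `x` of one block `o` as base point and write the variables of
the other blocks as `x + z_v / N`. The sum over `i` then factors into normalised Dirichlet kernels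
`D_N(z_{b(k+1)} - z_{b(k)})` along the closed walk `b` that sends `k` to its block, and all powers
of `N` cancel (`expansionCoeffN_eq_integral`). Formally the limit replaces `D_N(w)` by `(e^{iw} -
1)/(iw)` and each density by `p(x)`.

The difficulty is domination: `|D_N(w)|` decays only like `1/|w|`, which is not integrable. But the
walk is a cycle, so after removal of any edge it still contains a spanning tree
(`exists_spanning_tree`). Removing the edge with the smallest kernel and distributing its modulus
over the tree edges raises each tree factor to the power `1 + 1/n` (`prod_le_prod_rpow_of_injOn`),
which is integrable over a period uniformly in `N` and in the centre. Integrating the tree from the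
leaves inwards (`lintegral_prod_tree_le`) bounds the integrals uniformly and makes their tails
uniformly small, hence the limit exists, first for fixed `x` and then after integration in `x`. It
is real because the reflection `i ↦ N - 1 - i` negates all exponents.

For the moments, the trace is expanded over maps `Fin n → Fin L`, which are partitions with
injectively labelled blocks (`bijective_comp_blockOf`). The number of labellings, divided by `L
N^{|ρ|-1}`, tends to `c^{|ρ|-1}`.

The same domination gives `|K_ρ| ≤ n (2πM(1+n))^{|ρ|-1}`, where `M` bounds the density. With at most
`n^n` partitions the limit moments are `O(Cⁿ (2n)!)`, exactly the growth at which a law on `[0, ∞)`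
is still determined by its moments (`ext_of_moments_of_le_factorial`). Bounded first moments give
compactness, every cluster point of the averaged laws has the limit moments (`moments_of_tendsto`),
and determinacy leaves a single cluster point. This yields existence and weak convergence together.
-/

namespace RandomVandermonde

/-! ### The normalised Dirichlet kernel -/

/-- The rescaled and normalised Dirichlet kernel `N⁻¹ ∑_{j < N} e^{i j w / N}`. -/
noncomputable def dirichletMean (N : ℕ) (w : ℝ) : ℂ :=
  (N : ℂ)⁻¹ * ∑ j : Fin N, Complex.exp (Complex.I * ((j : ℕ) : ℂ) * ((w / N : ℝ) : ℂ))

theorem dirichletMean_eq_geom_sum (N : ℕ) (w : ℝ) :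
    dirichletMean N w =
      (N : ℂ)⁻¹ * ∑ j ∈ Finset.range N, Complex.exp (Complex.I * ((w / N : ℝ) : ℂ)) ^ j := by
  rw [dirichletMean, ← Fin.sum_univ_eq_sum_range
    (fun j => Complex.exp (Complex.I * ((w / N : ℝ) : ℂ)) ^ j)]
  congr 1
  refine Finset.sum_congr rfl fun j _ => ?_
  rw [← Complex.exp_nat_mul]
  congr 1
  ring

theorem continuous_dirichletMean (N : ℕ) : Continuous (dirichletMean N) := by
  unfold dirichletMean
  fun_prop

theorem norm_dirichletMean_le_one (N : ℕ) (w : ℝ) : ‖dirichletMean N w‖ ≤ 1 := by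
  rcases Nat.eq_zero_or_pos N with rfl | hN
  · simp [dirichletMean]
  have hN' : (0 : ℝ) < N := by exact_mod_cast hN
  rw [dirichletMean, norm_mul, norm_inv, Complex.norm_natCast, inv_mul_le_iff₀ hN', mul_one]
  refine (norm_sum_le _ _).trans ?_
  have : ∀ j : Fin N,
      ‖Complex.exp (Complex.I * ((j : ℕ) : ℂ) * ((w / N : ℝ) : ℂ))‖ = 1 := fun j => by
    rw [show Complex.I * ((j : ℕ) : ℂ) * ((w / N : ℝ) : ℂ)
      = (((j : ℕ) * (w / N) : ℝ) : ℂ) * Complex.I by push_cast; ring,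
      Complex.norm_exp_ofReal_mul_I]
  rw [Finset.sum_congr rfl fun j _ => this j]
  simp

theorem dirichletMean_neg (N : ℕ) (w : ℝ) :
    dirichletMean N (-w) = (starRingEnd ℂ) (dirichletMean N w) := by
  simp only [dirichletMean, map_mul, map_inv₀, map_natCast, map_sum, ← Complex.exp_conj,
    Complex.conj_I, Complex.conj_ofReal]
  congr 1
  refine Finset.sum_congr rfl fun j _ => ?_
  congr 1
  push_cast
  ring

theorem norm_dirichletMean_neg (N : ℕ) (w : ℝ) :
    ‖dirichletMean N (-w)‖ = ‖dirichletMean N w‖ := by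
  rw [dirichletMean_neg, RCLike.norm_conj]

theorem dirichletMean_periodic {N : ℕ} (hN : 0 < N) :
    Function.Periodic (dirichletMean N) (2 * Real.pi * N) := by
  intro w
  have hN' : (N : ℝ) ≠ 0 := by exact_mod_cast hN.ne'
  rw [dirichletMean_eq_geom_sum, dirichletMean_eq_geom_sum]
  have : Complex.exp (Complex.I * (((w + 2 * Real.pi * N) / N : ℝ) : ℂ))
      = Complex.exp (Complex.I * ((w / N : ℝ) : ℂ)) := by
    rw [add_div, mul_div_assoc, div_self hN', mul_one, Complex.ofReal_add, mul_add, Complex.exp_add,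
      show Complex.I * ((2 * Real.pi : ℝ) : ℂ) = 2 * Real.pi * Complex.I by push_cast; ring,
      Complex.exp_two_pi_mul_I, mul_one]
  rw [this]

/-- Jordan's inequality `sin y ≥ 2y/π` on `[0, π/2]`, applied to `|e^{ix} - 1| = 2 |sin (x/2)|`. -/
theorem norm_exp_I_mul_sub_one_ge {x : ℝ} (hx : |x| ≤ Real.pi) :
    2 / Real.pi * |x| ≤ ‖Complex.exp (Complex.I * x) - 1‖ := by
  rw [Complex.norm_exp_I_mul_ofReal_sub_one, norm_mul, Real.norm_ofNat, Real.norm_eq_abs]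
  have key : ∀ y : ℝ, 0 ≤ y → y ≤ Real.pi → 2 / Real.pi * y ≤ 2 * |Real.sin (y / 2)| := by
    intro y h0 h1
    have := Real.mul_le_sin (x := y / 2) (by linarith) (by linarith)
    have h2 := le_abs_self (Real.sin (y / 2))
    calc 2 / Real.pi * y = 2 * (2 / Real.pi * (y / 2)) := by ring
      _ ≤ _ := by linarith
  rcases le_total 0 x with h | h
  · rw [abs_of_nonneg h] at hx ⊢
    exact key x h hx
  · rw [abs_of_nonpos h] at hx ⊢
    have := key (-x) (by linarith) hx
    rwa [neg_div, Real.sin_neg, abs_neg] at this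

/-- In the closed form of the geometric sum the numerator is at most `2` and Jordan's inequality
bounds the denominator below. The factor `N` cancels, so the decay is uniform in `N`, but it just
fails to be integrable. -/
theorem norm_dirichletMean_le_div {N : ℕ} {w : ℝ} (hw0 : w ≠ 0)
    (hw : |w| ≤ Real.pi * N) : ‖dirichletMean N w‖ ≤ Real.pi / |w| := by
  rcases Nat.eq_zero_or_pos N with rfl | hN
  · have := abs_pos.2 hw0
    simp at hw
    exact absurd hw hw0
  have hN' : (0 : ℝ) < N := by exact_mod_cast hN
  have hwp : 0 < |w| := abs_pos.2 hw0
  have h1 : |w / N| ≤ Real.pi := by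
    rw [abs_div, abs_of_pos hN', div_le_iff₀ hN']
    exact hw
  have h2 := norm_exp_I_mul_sub_one_ge h1
  have h3 : 0 < 2 / Real.pi * |w / N| := by
    have := Real.pi_pos
    rw [abs_div, abs_of_pos hN']
    positivity
  have hne : Complex.exp (Complex.I * ((w / N : ℝ) : ℂ)) ≠ 1 := by
    intro h
    rw [h, sub_self, norm_zero] at h2
    linarith
  rw [dirichletMean_eq_geom_sum, geom_sum_eq hne, norm_mul, norm_inv, Complex.norm_natCast,
    norm_div]
  have h4 : ‖Complex.exp (Complex.I * ((w / N : ℝ) : ℂ)) ^ N - 1‖ ≤ 2 := by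
    refine (norm_sub_le _ _).trans ?_
    rw [norm_pow, mul_comm Complex.I, Complex.norm_exp_ofReal_mul_I]
    norm_num
  have hpi := Real.pi_pos
  calc (N : ℝ)⁻¹ * (‖Complex.exp (Complex.I * ((w / N : ℝ) : ℂ)) ^ N - 1‖ /
        ‖Complex.exp (Complex.I * ((w / N : ℝ) : ℂ)) - 1‖)
      ≤ (N : ℝ)⁻¹ * (2 / (2 / Real.pi * |w / N|)) := by gcongr
    _ = Real.pi / |w| := by
      rw [abs_div, abs_of_pos hN']
      field_simp

/-- The means are Riemann sums of `∫₀¹ e^{isw} ds`. Only the existence of the limit matters later.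
-/
theorem exists_tendsto_dirichletMean (w : ℝ) :
    ∃ l : ℂ, Tendsto (fun N => dirichletMean N w) atTop (𝓝 l) := by
  by_cases hw : w = 0
  · refine ⟨1, tendsto_const_nhds.congr' ?_⟩
    filter_upwards [eventually_gt_atTop 0] with N hN
    have : (N : ℂ) ≠ 0 := by exact_mod_cast hN.ne'
    simp [dirichletMean, hw, this]
  set d : ℂ := Complex.I * w with hd
  have hd0 : d ≠ 0 := mul_ne_zero Complex.I_ne_zero (by exact_mod_cast hw)
  -- The derivative of `h ↦ e^{dh}` at `0`, read along `h = 1/N`.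
  have hderiv : Tendsto (fun N : ℕ => (N : ℂ) * (Complex.exp (d / N) - 1)) atTop (𝓝 d) := by
    have h := (((hasDerivAt_id (0 : ℂ)).const_mul d).cexp).tendsto_slope_zero
    simp only [id_eq, mul_zero, Complex.exp_zero, one_mul, mul_one, zero_add, smul_eq_mul] at h
    have h2 : Tendsto (fun N : ℕ => (N : ℂ)⁻¹) atTop (𝓝[≠] 0) := by
      rw [tendsto_nhdsWithin_iff]
      refine ⟨tendsto_inv_atTop_nhds_zero_nat, ?_⟩
      filter_upwards [eventually_gt_atTop 0] with N hN
      simp [hN.ne']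
    refine (h.comp h2).congr fun N => ?_
    simp [div_eq_mul_inv]
  refine ⟨(Complex.exp d - 1) / d, ((tendsto_const_nhds (x := Complex.exp d - 1)).div hderiv
    hd0).congr' ?_⟩
  have hlarge : ∀ᶠ N : ℕ in atTop, |w| ≤ Real.pi * N :=
    (tendsto_natCast_atTop_atTop.const_mul_atTop Real.pi_pos).eventually_ge_atTop _
  filter_upwards [eventually_gt_atTop 0, hlarge] with N hN hwN
  have hN' : (0 : ℝ) < N := by exact_mod_cast hN
  have hN'' : (N : ℂ) ≠ 0 := by exact_mod_cast hN.ne'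
  have h1 : |w / N| ≤ Real.pi := by
    rw [abs_div, abs_of_pos hN', div_le_iff₀ hN']
    exact hwN
  have hne : Complex.exp (Complex.I * ((w / N : ℝ) : ℂ)) ≠ 1 := by
    intro h
    have h2 := norm_exp_I_mul_sub_one_ge h1
    rw [h, sub_self, norm_zero] at h2
    have : 0 < 2 / Real.pi * |w / N| := by
      have := Real.pi_pos
      have := abs_pos.2 hw
      rw [abs_div, abs_of_pos hN']
      positivity
    linarith
  have e1 : Complex.I * ((w / N : ℝ) : ℂ) = d / N := by
    rw [hd]; push_cast; ring
  rw [dirichletMean_eq_geom_sum, geom_sum_eq hne, e1, ← Complex.exp_nat_mul,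
    mul_div_cancel₀ _ hN'', Pi.div_apply]
  rw [div_eq_mul_inv, div_eq_mul_inv, mul_inv]
  ring

/-! ### Integral bounds for the kernel -/

theorem lintegral_Ioi_rpow_tail {s δ : ℝ} (hs : 0 < s) (hδ : 0 < δ) :
    ∫⁻ w in Set.Ioi δ, ENNReal.ofReal ((Real.pi / w) ^ (1 + s)) =
      ENNReal.ofReal (Real.pi ^ (1 + s) * δ ^ (-s) / s) := by
  have hlt : -(1 + s) < -1 := by linarith
  have h1 : ∀ w ∈ Set.Ioi δ, (Real.pi / w) ^ (1 + s) = Real.pi ^ (1 + s) * w ^ (-(1 + s)) := by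
    intro w hw
    have hw : 0 < w := hδ.trans hw
    rw [Real.div_rpow Real.pi_pos.le hw.le, Real.rpow_neg hw.le, div_eq_mul_inv]
  rw [setLIntegral_congr_fun measurableSet_Ioi fun w hw => by
    show ENNReal.ofReal ((Real.pi / w) ^ (1 + s))
      = ENNReal.ofReal (Real.pi ^ (1 + s) * w ^ (-(1 + s)))
    rw [h1 w hw]]
  rw [← ofReal_integral_eq_lintegral_ofReal
    ((integrableOn_Ioi_rpow_of_lt hlt hδ).const_mul _)]
  · rw [integral_const_mul, integral_Ioi_rpow_of_lt hlt hδ]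
    congr 1
    rw [show -(1 + s) + 1 = -s by ring]
    field_simp
  · refine (ae_restrict_iff' measurableSet_Ioi).2 (Eventually.of_forall fun w hw => ?_)
    have hw : 0 < w := hδ.trans hw
    have := Real.pi_pos
    simp only [Pi.zero_apply]
    positivity

theorem enorm_dirichletMean_rpow_le {N : ℕ} {w s : ℝ} (hs : 0 < s) (hw0 : w ≠ 0)
    (hw : |w| ≤ Real.pi * N) :
    ‖dirichletMean N w‖ₑ ^ (1 + s) ≤ ENNReal.ofReal ((Real.pi / |w|) ^ (1 + s)) := by
  have hpi := Real.pi_pos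
  rw [← ENNReal.ofReal_rpow_of_nonneg (by positivity) (by linarith), ← ofReal_norm]
  gcongr
  exact norm_dirichletMean_le_div hw0 hw

/-- The truncation of `|D_N|^{1+s}` to the part at distance greater than `δ` from the periods. -/
noncomputable def dirichletTail (N : ℕ) (s δ : ℝ) (w : ℝ) : ℝ≥0∞ :=
  Set.indicator {w : ℝ | δ < ‖(w : AddCircle (2 * Real.pi * N))‖}
    (fun w => ‖dirichletMean N w‖ₑ ^ (1 + s)) w

theorem measurable_dirichletTail (N : ℕ) (s δ : ℝ) : Measurable (dirichletTail N s δ) := by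
  unfold dirichletTail
  refine Measurable.indicator ?_ ?_
  · exact ((continuous_dirichletMean N).measurable.enorm).pow_const _
  · have : Continuous fun w : ℝ => ‖(w : AddCircle (2 * Real.pi * N))‖ :=
      continuous_norm.comp (AddCircle.continuous_mk' _)
    exact measurableSet_lt measurable_const this.measurable

theorem setLIntegral_abs_gt_rpow {s δ : ℝ} (hs : 0 < s) (hδ : 0 < δ) :
    ∫⁻ w in {w : ℝ | δ < |w|}, ENNReal.ofReal ((Real.pi / |w|) ^ (1 + s)) ≤
      ENNReal.ofReal (2 * (Real.pi ^ (1 + s) * δ ^ (-s) / s)) := by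
  have hset : {w : ℝ | δ < |w|} = Set.Ioi δ ∪ Set.Iio (-δ) := by
    ext w
    simp only [Set.mem_ofPred_eq, Set.mem_union, Set.mem_Ioi, Set.mem_Iio, lt_abs, lt_neg]
  have hpi := Real.pi_pos
  have hI : ∫⁻ w in Set.Ioi δ, ENNReal.ofReal ((Real.pi / |w|) ^ (1 + s)) =
      ENNReal.ofReal (Real.pi ^ (1 + s) * δ ^ (-s) / s) := by
    rw [← lintegral_Ioi_rpow_tail hs hδ]
    refine setLIntegral_congr_fun measurableSet_Ioi fun w hw => ?_
    rw [abs_of_pos (hδ.trans hw)]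
  have hJ : ∫⁻ w in Set.Iio (-δ), ENNReal.ofReal ((Real.pi / |w|) ^ (1 + s)) =
      ENNReal.ofReal (Real.pi ^ (1 + s) * δ ^ (-s) / s) := by
    have h := (Measure.measurePreserving_neg (volume : Measure ℝ)).setLIntegral_comp_preimage_emb
      (MeasurableEquiv.neg ℝ).measurableEmbedding
      (fun w => ENNReal.ofReal ((Real.pi / |w|) ^ (1 + s))) (Set.Ioi δ)
    have hpre : Neg.neg ⁻¹' Set.Ioi δ = Set.Iio (-δ) := by
      ext w
      simp
    rw [← hI, ← h, hpre]
    simp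
  rw [hset]
  refine (lintegral_union_le _ _ _).trans ?_
  rw [hI, hJ, ← ENNReal.ofReal_add (by positivity) (by positivity), two_mul]

/-- The distance from `w` to the period lattice is at most `|w|`, so the truncated kernel lives on
`δ < |w|`, where the `π/|w|` bound applies. -/
theorem setLIntegral_dirichletTail_le (N : ℕ) {s δ : ℝ} (hs : 0 < s) (hδ : 0 < δ) :
    ∫⁻ w in Set.Icc (-(Real.pi * N)) (Real.pi * N), dirichletTail N s δ w ≤
      ENNReal.ofReal (2 * (Real.pi ^ (1 + s) * δ ^ (-s) / s)) := by
  refine le_trans ?_ (setLIntegral_abs_gt_rpow hs hδ)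
  have hm : MeasurableSet {w : ℝ | δ < |w|} := measurableSet_lt measurable_const measurable_norm
  rw [← lintegral_indicator hm, ← lintegral_indicator measurableSet_Icc]
  refine lintegral_mono fun w => ?_
  by_cases hw : w ∈ Set.Icc (-(Real.pi * N)) (Real.pi * N)
  · rw [Set.indicator_of_mem hw]
    have hw' : |w| ≤ Real.pi * N := abs_le.2 hw
    rw [dirichletTail]
    by_cases hwt : w ∈ {w : ℝ | δ < ‖(w : AddCircle (2 * Real.pi * N))‖}
    · rw [Set.indicator_of_mem hwt]
      have hlt : δ < |w| := by
        refine lt_of_lt_of_le hwt ?_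
        exact QuotientAddGroup.norm_mk_le_norm
      rw [Set.indicator_of_mem (show w ∈ {w : ℝ | δ < |w|} from hlt)]
      exact enorm_dirichletMean_rpow_le hs (abs_pos.1 (hδ.trans hlt)) hw'
    · rw [Set.indicator_of_notMem hwt]
      exact zero_le
  · rw [Set.indicator_of_notMem hw]
    exact zero_le

/-- The bounds `1` and `π/|w|` cross at `|w| = π`. The inner part contributes `2π` and the outer
part `2π/s`. -/
theorem setLIntegral_enorm_dirichletMean_rpow_le (N : ℕ) {s : ℝ} (hs : 0 < s) :
    ∫⁻ w in Set.Icc (-(Real.pi * N)) (Real.pi * N), ‖dirichletMean N w‖ₑ ^ (1 + s) ≤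
      ENNReal.ofReal (2 * Real.pi * (1 + 1 / s)) := by
  have hpi := Real.pi_pos
  have hm : MeasurableSet {w : ℝ | Real.pi < |w|} := measurableSet_lt measurable_const measurable_norm
  calc ∫⁻ w in Set.Icc (-(Real.pi * N)) (Real.pi * N), ‖dirichletMean N w‖ₑ ^ (1 + s)
      ≤ ∫⁻ w, ((Set.Icc (-Real.pi) Real.pi).indicator (fun _ => (1 : ℝ≥0∞)) w +
          {w : ℝ | Real.pi < |w|}.indicator
            (fun w => ENNReal.ofReal ((Real.pi / |w|) ^ (1 + s))) w) := by
        rw [← lintegral_indicator measurableSet_Icc]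
        refine lintegral_mono fun w => ?_
        by_cases hw : w ∈ Set.Icc (-(Real.pi * N)) (Real.pi * N)
        · rw [Set.indicator_of_mem hw]
          by_cases hw1 : Real.pi < |w|
          · refine le_add_left ?_
            rw [Set.indicator_of_mem (show w ∈ {w : ℝ | Real.pi < |w|} from hw1)]
            exact enorm_dirichletMean_rpow_le hs (abs_pos.1 (hpi.trans hw1)) (abs_le.2 hw)
          · refine le_add_right ?_
            rw [Set.indicator_of_mem (show w ∈ Set.Icc _ _ from abs_le.1 (not_lt.1 hw1))]
            refine ENNReal.rpow_le_one ?_ (by linarith)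
            rw [← ofReal_norm]
            exact ENNReal.ofReal_le_one.2 (norm_dirichletMean_le_one N w)
        · rw [Set.indicator_of_notMem hw]
          exact zero_le
    _ ≤ ENNReal.ofReal (2 * Real.pi) +
          ENNReal.ofReal (2 * (Real.pi ^ (1 + s) * Real.pi ^ (-s) / s)) := by
        rw [lintegral_add_left (measurable_const.indicator measurableSet_Icc),
          lintegral_indicator measurableSet_Icc, lintegral_indicator hm]
        gcongr
        · simp [two_mul]
        · exact setLIntegral_abs_gt_rpow hs hpi
    _ = _ := by
        rw [← ENNReal.ofReal_add (by positivity) (by positivity), ← Real.rpow_add hpi,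
          show 1 + s + -s = 1 by ring, Real.rpow_one]
        congr 1
        field_simp

/-- The box is a full period, so the centre `a` is irrelevant. This makes the one-variable bounds
uniform in the position of the parent vertex when a tree is integrated out. -/
theorem setLIntegral_Icc_comp_sub_of_periodic {N : ℕ} (hN : 0 < N) {F : ℝ → ℝ≥0∞}
    (hF : Function.Periodic F (2 * Real.pi * N)) (a : ℝ) :
    ∫⁻ z in Set.Icc (-(Real.pi * N)) (Real.pi * N), F (z - a) =
      ∫⁻ z in Set.Icc (-(Real.pi * N)) (Real.pi * N), F z := by
  have hpi := Real.pi_pos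
  have hT : 0 < 2 * Real.pi * N := by
    have : (0 : ℝ) < N := by exact_mod_cast hN
    positivity
  have h1 : ∫⁻ z in Set.Ioc (-(Real.pi * N)) (Real.pi * N), F (z - a) =
      ∫⁻ z in Set.Ioc (-(Real.pi * N) - a) (Real.pi * N - a), F z := by
    have h := (measurePreserving_sub_right (volume : Measure ℝ) a).setLIntegral_comp_preimage_emb
      (MeasurableEquiv.subRight a).measurableEmbedding F
      (Set.Ioc (-(Real.pi * N) - a) (Real.pi * N - a))
    simpa [Set.preimage_sub_const_Ioc] using h
  rw [← restrict_Ioc_eq_restrict_Icc, h1]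
  have e1 : Real.pi * N - a = (-(Real.pi * N) - a) + 2 * Real.pi * N := by ring
  have e2 : Real.pi * N = -(Real.pi * N) + 2 * Real.pi * N := by ring
  rw [e1]
  conv_rhs => rw [show Set.Ioc (-(Real.pi * N)) (Real.pi * (N : ℝ))
    = Set.Ioc (-(Real.pi * N)) (-(Real.pi * N) + 2 * Real.pi * N) by rw [← e2]]
  -- Both intervals are fundamental domains for translation by multiples of `2πN`.
  refine (isAddFundamentalDomain_Ioc hT _).setLIntegral_eq (isAddFundamentalDomain_Ioc hT _) F ?_
  rintro ⟨g, hg⟩ x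
  obtain ⟨k, rfl⟩ := AddSubgroup.mem_zmultiples_iff.1 hg
  rw [AddSubgroup.vadd_def, vadd_eq_add, add_comm]
  exact hF.zsmul k x

theorem setLIntegral_enorm_dirichletMean_sub_rpow_le {N : ℕ} (hN : 0 < N) {s : ℝ} (hs : 0 < s)
    (a : ℝ) :
    ∫⁻ z in Set.Icc (-(Real.pi * N)) (Real.pi * N), ‖dirichletMean N (z - a)‖ₑ ^ (1 + s) ≤
      ENNReal.ofReal (2 * Real.pi * (1 + 1 / s)) := by
  rw [setLIntegral_Icc_comp_sub_of_periodic (F := fun w => ‖dirichletMean N w‖ₑ ^ (1 + s)) hN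
    fun w => by simp only [dirichletMean_periodic hN w]]
  exact setLIntegral_enorm_dirichletMean_rpow_le N hs

theorem setLIntegral_dirichletTail_sub_le {N : ℕ} (hN : 0 < N) {s δ : ℝ} (hs : 0 < s)
    (hδ : 0 < δ) (a : ℝ) :
    ∫⁻ z in Set.Icc (-(Real.pi * N)) (Real.pi * N), dirichletTail N s δ (z - a) ≤
      ENNReal.ofReal (2 * (Real.pi ^ (1 + s) * δ ^ (-s) / s)) := by
  rw [setLIntegral_Icc_comp_sub_of_periodic hN]
  · exact setLIntegral_dirichletTail_le N hs hδ
  · intro w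
    have : ((w + 2 * Real.pi * N : ℝ) : AddCircle (2 * Real.pi * N)) = w :=
      AddCircle.coe_add_period _ w
    simp only [dirichletTail, Set.indicator, Set.mem_ofPred_eq, this, dirichletMean_periodic hN w]

end RandomVandermonde

namespace RandomVandermonde

/-! ### Integrals of products along a rooted tree -/

/-- Vertices are integrated out in order of decreasing rank. A vertex of maximal rank among those
remaining is the parent of none of them, so its variable occurs only in its own factor, and `H v`
bounds that integral wherever the parent lies. The root contributes its total mass. -/
theorem lintegral_prod_tree_le {V : Type*} [Fintype V] [DecidableEq V] {μ : V → Measure ℝ}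
    [∀ v, SigmaFinite (μ v)] (o : V) (ho : μ o Set.univ ≤ 1) (u : V → V) (rank : V → ℕ)
    (hrank : ∀ v, v ≠ o → rank (u v) < rank v) (h : V → ℝ → ℝ → ℝ≥0∞)
    (hm : ∀ v, Measurable (Function.uncurry (h v))) (H : V → ℝ≥0∞)
    (hH : ∀ v, v ≠ o → ∀ a, ∫⁻ z, h v z a ∂μ v ≤ H v) :
    ∫⁻ z, ∏ v ∈ Finset.univ.erase o, h v (z v) (z (u v)) ∂Measure.pi μ ≤
      ∏ v ∈ Finset.univ.erase o, H v := by
  have hmeas : ∀ s : Finset V,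
      Measurable fun z : V → ℝ => ∏ v ∈ s, h v (z v) (z (u v)) := fun s =>
    Finset.measurable_fun_prod _ fun v _ =>
      show Measurable (Function.uncurry (h v) ∘ fun z : V → ℝ => (z v, z (u v))) from
        (hm v).comp ((measurable_pi_apply v).prodMk (measurable_pi_apply (u v)))
  have key : ∀ s : Finset V, o ∉ s → ∀ x,
      (∫⋯∫⁻_s, (fun z => ∏ v ∈ s, h v (z v) (z (u v))) ∂μ) x ≤ ∏ v ∈ s, H v := by
    intro s
    refine Finset.induction_on_max_value rank s (by simp) ?_
    intro a s has hmax ih hos x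
    have hao : a ≠ o := fun hh => hos (hh ▸ Finset.mem_insert_self a s)
    have hos' : o ∉ s := fun hh => hos (Finset.mem_insert_of_mem hh)
    rw [lmarginal_insert' _ (hmeas _) has]
    have hle : (fun x : V → ℝ => ∫⁻ xᵢ, ∏ v ∈ insert a s,
        h v (Function.update x a xᵢ v) (Function.update x a xᵢ (u v)) ∂μ a) ≤
        fun x => H a * ∏ v ∈ s, h v (x v) (x (u v)) := by
      intro y
      have hua : u a ≠ a := fun hh => by
        have := hrank a hao
        rw [hh] at this
        exact lt_irrefl _ this
      have : ∀ t : ℝ, ∏ v ∈ insert a s,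
          h v (Function.update y a t v) (Function.update y a t (u v)) =
          h a t (y (u a)) * ∏ v ∈ s, h v (y v) (y (u v)) := by
        intro t
        rw [Finset.prod_insert has, Function.update_self, Function.update_of_ne hua]
        congr 1
        refine Finset.prod_congr rfl fun v hv => ?_
        have hva : v ≠ a := fun hh => has (hh ▸ hv)
        -- If `a` were the parent of `v`, its rank would be smaller than that of `v`, against
        -- maximality.
        have huva : u v ≠ a := fun hh => by
          have h1 := hrank v (fun hh => hos' (hh ▸ hv))
          have h2 := hmax v hv
          rw [hh] at h1
          omega
        rw [Function.update_of_ne hva, Function.update_of_ne huva]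
      simp only [this]
      have hma : Measurable fun t => h a t (y (u a)) :=
        show Measurable (Function.uncurry (h a) ∘ fun t : ℝ => (t, y (u a))) from
          (hm a).comp (measurable_id.prodMk measurable_const)
      rw [lintegral_mul_const _ hma]
      gcongr
      exact hH a hao _
    refine (lmarginal_mono hle x).trans ?_
    rw [Finset.prod_insert has]
    refine le_trans (le_of_eq ?_) (mul_le_mul_right (ih hos' x) (H a))
    simp only [lmarginal]
    rw [lintegral_const_mul]
    exact (hmeas s).comp measurable_updateFinset
  have hG := hmeas (Finset.univ.erase o)
  have hbound := key _ (Finset.notMem_erase o Finset.univ)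
  set G := fun z : V → ℝ => ∏ v ∈ Finset.univ.erase o, h v (z v) (z (u v))
  rw [lintegral_eq_lmarginal_univ (fun _ => 0), lmarginal_erase _ hG (Finset.mem_univ o)]
  calc _ ≤ ∫⁻ _, ∏ v ∈ Finset.univ.erase o, H v ∂μ o := lintegral_mono fun t => hbound _
    _ = (∏ v ∈ Finset.univ.erase o, H v) * μ o Set.univ := lintegral_const _
    _ ≤ _ := (mul_le_mul_right ho _).trans (mul_one _).le

/-! ### Spanning trees of a cyclic walk with one edge removed -/

/-- Removing one edge `e` from a cyclic walk `b` that visits every vertex leaves a connected graph: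
every vertex other than the starting one has a parent, joined to it by an edge `≠ e`, and distinct
vertices use distinct edges. -/
theorem exists_spanning_tree {V : Type*} {n : ℕ} (hn : 0 < n) (b : Fin n → V)
    (hb : Function.Surjective b) (e : Fin n) :
    ∃ (u : V → V) (edge : V → Fin n) (rank : V → ℕ),
      (∀ v, rank v ≤ 2 * n) ∧
      (∀ v, v ≠ b ⟨0, hn⟩ → rank (u v) < rank v ∧ edge v ≠ e ∧
        ((b (edge v) = v ∧ b (finRotate n (edge v)) = u v) ∨
          (b (edge v) = u v ∧ b (finRotate n (edge v)) = v))) ∧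
      Set.InjOn edge {v | v ≠ b ⟨0, hn⟩} := by
  classical
  obtain ⟨t, rfl⟩ : ∃ t, n = t + 1 := ⟨n - 1, by omega⟩
  -- The cycle is cut at the edge `e`, between positions `e` and `e + 1`. Starting from position
  -- `0`, `τ` orders first the positions `0, …, e` going forward, then `t, …, e + 1` going backward;
  -- the second group has values above `t + 1`. Each vertex is represented by the position `κ v` at
  -- which it first appears in this order.
  let τ : Fin (t + 1) → ℕ := fun k => if k ≤ e then (k : ℕ) else 2 * (t + 1) - k
  have hmin : ∀ v : V, ∃ k, b k = v ∧ ∀ j, b j = v → τ k ≤ τ j := by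
    intro v
    obtain ⟨k0, hk0⟩ := hb v
    obtain ⟨k, hk, hkm⟩ := Finset.exists_min_image (Finset.univ.filter fun k => b k = v) τ
      ⟨k0, by simp [hk0]⟩
    refine ⟨k, by simpa using hk, fun j hj => hkm j (by simp [hj])⟩
  choose κ hκ hκm using hmin
  let pd : Fin (t + 1) → Fin (t + 1) := fun k => ⟨(k : ℕ) - 1, by omega⟩
  have hκ0 : ∀ v, v ≠ b ⟨0, hn⟩ → 0 < (κ v : ℕ) := by
    intro v hv
    rcases Nat.eq_zero_or_pos (κ v : ℕ) with h0 | h0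
    · exact absurd (by rw [← hκ v]; congr 1; exact Fin.ext h0) hv
    · exact h0
  have hpd : ∀ v, v ≠ b ⟨0, hn⟩ → finRotate (t + 1) (pd (κ v)) = κ v := by
    intro v hv
    have h0 := hκ0 v hv
    have hne : pd (κ v) ≠ Fin.last t := by
      intro hh
      have := congrArg Fin.val hh
      simp only [pd, Fin.val_last] at this
      have := (κ v).isLt
      omega
    ext
    rw [coe_finRotate_of_ne_last hne]
    simp only [pd]
    omega
  -- The parent sits at the next position towards `0` in the cut cycle. Forward positions use edges
  -- `< e` and backward ones use edges `> e`, so `e` is avoided and the edge determines `κ v`.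
  refine ⟨fun v => if κ v ≤ e then b (pd (κ v)) else b (finRotate _ (κ v)),
    fun v => if κ v ≤ e then pd (κ v) else κ v, fun v => τ (κ v), ?_, ?_, ?_⟩
  · intro v
    simp only [τ]
    have := (κ v).isLt
    split_ifs <;> omega
  · intro v hv
    have h0 := hκ0 v hv
    by_cases hle : κ v ≤ e
    · simp only [hle, if_true]
      have hle' : (κ v : ℕ) ≤ e := hle
      refine ⟨?_, ?_, Or.inr ⟨trivial, ?_⟩⟩
      · refine lt_of_le_of_lt (hκm _ (pd (κ v)) rfl) ?_
        have hle2 : pd (κ v) ≤ e := by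
          rw [Fin.le_def]
          simp only [pd]
          omega
        simp only [τ, hle, hle2, if_true]
        simp only [pd]
        omega
      · intro hh
        have := congrArg Fin.val hh
        simp only [pd] at this
        omega
      · rw [hpd v hv, hκ]
    · simp only [hle, if_false]
      have hle' : (e : ℕ) < κ v := not_le.1 hle
      refine ⟨?_, ?_, Or.inl ⟨hκ v, trivial⟩⟩
      · refine lt_of_le_of_lt (hκm _ (finRotate _ (κ v)) rfl) ?_
        have hlt := (κ v).isLt
        by_cases hlast : κ v = Fin.last t
        · rw [hlast] at hle ⊢
          simp only [τ, hle, if_false, finRotate_last, Fin.zero_le, if_true, Fin.val_last,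
            Fin.val_zero]
          omega
        · have hc := coe_finRotate_of_ne_last hlast
          have : ¬ finRotate (t + 1) (κ v) ≤ e := by
            rw [Fin.le_def, hc]
            omega
          simp only [τ, hle, this, if_false, hc]
          omega
      · intro hh
        omega
  · intro v hv w hw hvw
    have h0 := hκ0 v hv
    have h0' := hκ0 w hw
    suffices κ v = κ w by rw [← hκ v, ← hκ w, this]
    have hvw' := congrArg Fin.val hvw
    simp only at hvw'
    ext
    by_cases h1 : κ v ≤ e <;> by_cases h2 : κ w ≤ e <;>
      simp only [h1, h2, if_true, if_false, pd] at hvw' <;>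
      rw [Fin.le_def] at h1 h2 <;> omega

/-- The smallest factor is written as `n` copies of its `n`-th root. Since all factors are at most
`1` and `s` has at most `n` elements, one copy can be given to each `v ∈ s` and enlarged to the
`n`-th root of `f (g v)`. -/
theorem prod_le_prod_rpow_of_injOn {ι V : Type*} [Fintype ι] [DecidableEq ι] (f : ι → ℝ≥0∞)
    (hf : ∀ k, f k ≤ 1) {e : ι} (he : ∀ k, f e ≤ f k) (s : Finset V) (g : V → ι)
    (hg : Set.InjOn g s) (hge : ∀ v ∈ s, g v ≠ e) :
    ∏ k, f k ≤ ∏ v ∈ s, f (g v) ^ (1 + 1 / (Fintype.card ι : ℝ)) := by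
  have hn : 0 < Fintype.card ι := Fintype.card_pos_iff.2 ⟨e⟩
  have hn' : (0 : ℝ) < Fintype.card ι := by exact_mod_cast hn
  have h1 : ∏ k ∈ Finset.univ.erase e, f k ≤ ∏ v ∈ s, f (g v) := by
    rw [← Finset.prod_image (f := f) hg]
    refine Finset.prod_le_prod_of_subset_of_le_one' (fun k hk => ?_) fun k _ _ => hf k
    obtain ⟨v, hv, rfl⟩ := Finset.mem_image.1 hk
    exact Finset.mem_erase.2 ⟨hge v hv, Finset.mem_univ _⟩
  have hcard : s.card ≤ Fintype.card ι := by
    rw [← Finset.card_image_of_injOn hg]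
    exact Finset.card_le_univ _
  have h2 : f e ≤ ∏ v ∈ s, f (g v) ^ (1 / (Fintype.card ι : ℝ)) := by
    calc f e = (f e ^ (1 / (Fintype.card ι : ℝ))) ^ Fintype.card ι := by
          rw [← ENNReal.rpow_natCast, ← ENNReal.rpow_mul, one_div_mul_cancel hn'.ne',
            ENNReal.rpow_one]
      _ ≤ (f e ^ (1 / (Fintype.card ι : ℝ))) ^ s.card :=
          pow_le_pow_right_of_le_one' (ENNReal.rpow_le_one (hf e) (by positivity)) hcard
      _ = ∏ v ∈ s, f e ^ (1 / (Fintype.card ι : ℝ)) := by rw [Finset.prod_const]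
      _ ≤ _ := Finset.prod_le_prod' fun v _ =>
          ENNReal.rpow_le_rpow (he _) (by positivity)
  calc ∏ k, f k = (∏ k ∈ Finset.univ.erase e, f k) * f e :=
        (Finset.prod_erase_mul _ _ (Finset.mem_univ e)).symm
    _ ≤ (∏ v ∈ s, f (g v)) * ∏ v ∈ s, f (g v) ^ (1 / (Fintype.card ι : ℝ)) := mul_le_mul' h1 h2
    _ = _ := by
      rw [← Finset.prod_mul_distrib]
      refine Finset.prod_congr rfl fun v _ => ?_
      rw [ENNReal.rpow_add_of_nonneg _ _ zero_le_one (by positivity), ENNReal.rpow_one]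

end RandomVandermonde

namespace RandomVandermonde

/-! ### Uniform bounds for the cyclic product of Dirichlet kernels -/

/-- The factors of Lebesgue measure on the functions `V → ℝ` that vanish at `o`. -/
noncomputable def pinnedFactor {V : Type*} [DecidableEq V] (o v : V) : Measure ℝ :=
  if v = o then Measure.dirac 0 else volume

instance {V : Type*} [DecidableEq V] (o v : V) : SigmaFinite (pinnedFactor o v) := by
  unfold pinnedFactor
  split_ifs <;> infer_instance

instance {V : Type*} [DecidableEq V] (o v : V) :
    IsFiniteMeasureOnCompacts (pinnedFactor o v) := by
  unfold pinnedFactor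
  split_ifs <;> infer_instance

theorem pinnedFactor_of_ne {V : Type*} [DecidableEq V] {o v : V} (h : v ≠ o) :
    pinnedFactor o v = volume := if_neg h

theorem pinnedFactor_self {V : Type*} [DecidableEq V] (o : V) :
    pinnedFactor o o = Measure.dirac 0 := if_pos rfl

/-- Lebesgue measure on the functions `V → ℝ` that vanish at `o`. -/
noncomputable def pinnedVolume {V : Type*} [Fintype V] [DecidableEq V] (o : V) :
    Measure (V → ℝ) :=
  Measure.pi (pinnedFactor o)

instance {V : Type*} [Fintype V] [DecidableEq V] (o : V) :
    IsFiniteMeasureOnCompacts (pinnedVolume o) := by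
  unfold pinnedVolume
  infer_instance

theorem ae_pinnedVolume_apply_eq_zero {V : Type*} [Fintype V] [DecidableEq V] (o : V) :
    ∀ᵐ z ∂pinnedVolume o, z o = 0 := by
  have h : ∀ᵐ t ∂pinnedFactor o o, t = 0 := by
    rw [pinnedFactor_self]
    exact (ae_dirac_iff (measurableSet_singleton 0)).2 rfl
  exact (Measure.tendsto_eval_ae_ae (μ := pinnedFactor o) (i := o)).eventually h

/-- The product of the kernels along the edges of a cyclic walk. -/
noncomputable def cycleKernel {V : Type*} {n : ℕ} (N : ℕ) (b : Fin n → V) (z : V → ℝ) : ℂ :=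
  ∏ k, dirichletMean N (z (b (finRotate n k)) - z (b k))

theorem continuous_cycleKernel {V : Type*} {n : ℕ} (N : ℕ) (b : Fin n → V) :
    Continuous (cycleKernel N b) := by
  unfold cycleKernel
  have := continuous_dirichletMean N
  fun_prop

theorem norm_cycleKernel_le_one {V : Type*} {n : ℕ} (N : ℕ) (b : Fin n → V) (z : V → ℝ) :
    ‖cycleKernel N b z‖ ≤ 1 := by
  rw [cycleKernel, norm_prod]
  exact Finset.prod_le_one (fun _ _ => norm_nonneg _) fun _ _ => norm_dirichletMean_le_one _ _

/-- The modulus of the kernel is even, so the direction in which the walk crosses an edge does not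
matter. -/
theorem enorm_dirichletMean_sub_of_edge {V : Type*} {n : ℕ} {N : ℕ} {b : Fin n → V} {k : Fin n}
    {v w : V} (h : (b k = v ∧ b (finRotate n k) = w) ∨ (b k = w ∧ b (finRotate n k) = v))
    (z : V → ℝ) :
    ‖dirichletMean N (z (b (finRotate n k)) - z (b k))‖ₑ = ‖dirichletMean N (z v - z w)‖ₑ := by
  rcases h with ⟨h1, h2⟩ | ⟨h1, h2⟩
  · rw [h1, h2, ← neg_sub, ← ofReal_norm, norm_dirichletMean_neg, ofReal_norm]
  · rw [h1, h2]

/-- The weakest edge depends on `z`. Summing over all candidates `e` removes this dependence at the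
cost of a factor `n`. -/
theorem enorm_cycleKernel_le {V : Type*} [Fintype V] [DecidableEq V] {n : ℕ} (hn : 0 < n)
    (b : Fin n → V) (u : Fin n → V → V) (edge : Fin n → V → Fin n)
    (hedge : ∀ e v, v ≠ b ⟨0, hn⟩ → edge e v ≠ e ∧
        ((b (edge e v) = v ∧ b (finRotate n (edge e v)) = u e v) ∨
          (b (edge e v) = u e v ∧ b (finRotate n (edge e v)) = v)))
    (hinj : ∀ e, Set.InjOn (edge e) {v | v ≠ b ⟨0, hn⟩}) (N : ℕ) (z : V → ℝ) :
    ‖cycleKernel N b z‖ₑ ≤ ∑ e, ∏ v ∈ Finset.univ.erase (b ⟨0, hn⟩),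
      ‖dirichletMean N (z v - z (u e v))‖ₑ ^ (1 + 1 / (n : ℝ)) := by
  set f : Fin n → ℝ≥0∞ := fun k => ‖dirichletMean N (z (b (finRotate n k)) - z (b k))‖ₑ with hf
  have hf1 : ∀ k, f k ≤ 1 := fun k => by
    rw [hf]
    simp only
    rw [← ofReal_norm]
    exact ENNReal.ofReal_le_one.2 (norm_dirichletMean_le_one _ _)
  obtain ⟨e, -, he⟩ := Finset.exists_min_image Finset.univ f ⟨⟨0, hn⟩, Finset.mem_univ _⟩
  have h1 : ‖cycleKernel N b z‖ₑ = ∏ k, f k := by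
    rw [cycleKernel, ← ofReal_norm, norm_prod, ENNReal.ofReal_prod_of_nonneg fun _ _ => norm_nonneg _]
    simp [hf]
  have hne : ∀ v ∈ Finset.univ.erase (b ⟨0, hn⟩), v ≠ b ⟨0, hn⟩ := fun v hv =>
    (Finset.mem_erase.1 hv).1
  have h2 := prod_le_prod_rpow_of_injOn f hf1 (fun k => he k (Finset.mem_univ k))
    (Finset.univ.erase (b ⟨0, hn⟩)) (edge e) ((hinj e).mono fun v hv => hne v hv)
    (fun v hv => (hedge e v (hne v hv)).1)
  rw [h1]
  refine h2.trans ?_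
  rw [Fintype.card_fin]
  refine le_trans (le_of_eq ?_) (Finset.single_le_sum (f := fun e =>
    ∏ v ∈ Finset.univ.erase (b ⟨0, hn⟩),
      ‖dirichletMean N (z v - z (u e v))‖ₑ ^ (1 + 1 / (n : ℝ))) (fun _ _ => zero_le)
      (Finset.mem_univ e))
  refine Finset.prod_congr rfl fun v hv => ?_
  rw [hf]
  simp only
  rw [enorm_dirichletMean_sub_of_edge (hedge e v (hne v hv)).2]

/-- If all tree differences were within `δ` of the period lattice, adding them along the path to the
root would put `z w` within `m δ` of it. Since `|z w|` is at most half a period, its distance to the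
lattice is `|z w|` itself. -/
theorem exists_norm_sub_parent_gt {V : Type*} {N : ℕ} (o : V) (u : V → V) (rank : V → ℕ)
    (hrank : ∀ v, v ≠ o → rank (u v) < rank v) {z : V → ℝ} (hz : z o = 0) {δ R : ℝ} (hδ : 0 ≤ δ)
    {m : ℕ} (hm : ∀ v, rank v ≤ m) (hR : m * δ ≤ R) {w : V} (hw : R < |z w|)
    (hwN : |z w| ≤ Real.pi * N) :
    ∃ v, v ≠ o ∧ δ < ‖((z v - z (u v) : ℝ) : AddCircle (2 * Real.pi * N))‖ := by
  by_contra! hcon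
  have key : ∀ r : ℕ, ∀ v, rank v ≤ r →
      ‖((z v : ℝ) : AddCircle (2 * Real.pi * N))‖ ≤ r * δ := by
    intro r
    induction r with
    | zero =>
      intro v hv
      by_cases hvo : v = o
      · simp [hvo, hz]
      · have := hrank v hvo
        omega
    | succ r ih =>
      intro v hv
      by_cases hvo : v = o
      · rw [hvo, hz]
        simp only [AddCircle.coe_zero, norm_zero]
        positivity
      · have h1 := ih (u v) (by have := hrank v hvo; omega)
        have h2 := hcon v hvo
        have : ((z v : ℝ) : AddCircle (2 * Real.pi * N)) =
            ((z v - z (u v) : ℝ) : AddCircle (2 * Real.pi * N)) + (z (u v) : ℝ) := by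
          rw [← AddCircle.coe_add, sub_add_cancel]
        rw [this]
        refine (norm_add_le _ _).trans ?_
        push_cast
        linarith
  have h1 := key m w (hm w)
  have hpi := Real.pi_pos
  rcases Nat.eq_zero_or_pos N with rfl | hN
  · have hR0 : 0 ≤ R := (by positivity : (0 : ℝ) ≤ m * δ).trans hR
    simp only [Nat.cast_zero, mul_zero] at hwN
    linarith
  have hT : 0 < 2 * Real.pi * N := by
    have : (0 : ℝ) < N := by exact_mod_cast hN
    positivity
  rw [(AddCircle.norm_coe_eq_abs_iff _ hT.ne').2 (by rw [abs_of_pos hT]; linarith)] at h1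
  linarith

/-- The function equal to `M` on `[-πN, πN]` and to `0` elsewhere. -/
noncomputable def boxWeight (N : ℕ) (M : ℝ≥0) (z : ℝ) : ℝ≥0∞ :=
  (Set.Icc (-(Real.pi * N)) (Real.pi * N)).indicator (fun _ => (M : ℝ≥0∞)) z

theorem measurable_boxWeight (N : ℕ) (M : ℝ≥0) : Measurable (boxWeight N M) :=
  measurable_const.indicator measurableSet_Icc

theorem lintegral_boxWeight_mul (N : ℕ) (M : ℝ≥0) {F : ℝ → ℝ≥0∞} (hF : Measurable F) :
    ∫⁻ z, boxWeight N M z * F z =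
      M * ∫⁻ z in Set.Icc (-(Real.pi * N)) (Real.pi * N), F z := by
  rw [← lintegral_const_mul _ hF, ← lintegral_indicator measurableSet_Icc]
  refine lintegral_congr fun z => ?_
  simp only [boxWeight, Set.indicator]
  split_ifs <;> simp

/-- The pinned integral of the modulus of the cyclic kernel is bounded, uniformly in `N`. -/
theorem lintegral_boxWeight_cycleKernel_le {V : Type*} [Fintype V] [DecidableEq V] {n : ℕ}
    (hn : 0 < n) (b : Fin n → V) (hb : Function.Surjective b) {N : ℕ} (hN : 0 < N) (M : ℝ≥0) :
    ∫⁻ z, (∏ v ∈ Finset.univ.erase (b ⟨0, hn⟩), boxWeight N M (z v)) * ‖cycleKernel N b z‖ₑ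
        ∂pinnedVolume (b ⟨0, hn⟩) ≤
      n * (M * ENNReal.ofReal (2 * Real.pi * (1 + n))) ^ (Fintype.card V - 1) := by
  choose u edge rank hrank hedge hinj using exists_spanning_tree hn b hb
  have hn' : (0 : ℝ) < n := by exact_mod_cast hn
  set o := b ⟨0, hn⟩ with ho
  have hDm : Measurable fun w => ‖dirichletMean N w‖ₑ ^ (1 + 1 / (n : ℝ)) :=
    (continuous_dirichletMean N).measurable.enorm.pow_const _
  have hsub : Measurable fun p : ℝ × ℝ => p.1 - p.2 := measurable_fst.sub measurable_snd
  have hT : ∀ e, ∫⁻ z, ∏ v ∈ Finset.univ.erase o,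
      (boxWeight N M (z v) * ‖dirichletMean N (z v - z (u e v))‖ₑ ^ (1 + 1 / (n : ℝ)))
        ∂pinnedVolume o ≤
      (M * ENNReal.ofReal (2 * Real.pi * (1 + n))) ^ (Fintype.card V - 1) := by
    intro e
    refine (lintegral_prod_tree_le o (by simp [pinnedFactor_self]) (u e) (rank e)
      (fun v hv => (hedge e v hv).1)
      (fun _ z a => boxWeight N M z * ‖dirichletMean N (z - a)‖ₑ ^ (1 + 1 / (n : ℝ)))
      (fun v => ?_) (fun _ => M * ENNReal.ofReal (2 * Real.pi * (1 + n))) ?_).trans ?_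
    · exact ((measurable_boxWeight N M).comp measurable_fst).mul (hDm.comp hsub)
    · intro v hv a
      rw [pinnedFactor_of_ne hv, lintegral_boxWeight_mul N M
        (F := fun z => ‖dirichletMean N (z - a)‖ₑ ^ (1 + 1 / (n : ℝ))) (hDm.comp (measurable_id.sub_const a))]
      gcongr
      have := setLIntegral_enorm_dirichletMean_sub_rpow_le hN (s := 1 / (n : ℝ))
        (by positivity) a
      simpa using this
    · rw [Finset.prod_const, Finset.card_erase_of_mem (Finset.mem_univ _), Finset.card_univ]
  calc _ ≤ ∫⁻ z, ∑ e, ∏ v ∈ Finset.univ.erase o,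
      (boxWeight N M (z v) * ‖dirichletMean N (z v - z (u e v))‖ₑ ^ (1 + 1 / (n : ℝ)))
        ∂pinnedVolume o := by
        refine lintegral_mono fun z => ?_
        simp only [Finset.prod_mul_distrib, ← Finset.mul_sum]
        gcongr
        exact enorm_cycleKernel_le hn b u edge (fun e v hv => (hedge e v hv).2) hinj N z
    _ = ∑ e, ∫⁻ z, ∏ v ∈ Finset.univ.erase o,
      (boxWeight N M (z v) * ‖dirichletMean N (z v - z (u e v))‖ₑ ^ (1 + 1 / (n : ℝ)))
        ∂pinnedVolume o := by
        refine lintegral_finsetSum _ fun e _ => Finset.measurable_fun_prod _ fun v _ => ?_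
        exact ((measurable_boxWeight N M).comp (measurable_pi_apply v)).mul
          (hDm.comp ((measurable_pi_apply v).sub (measurable_pi_apply _)))
    _ ≤ ∑ _e : Fin n, (M * ENNReal.ofReal (2 * Real.pi * (1 + n))) ^ (Fintype.card V - 1) :=
        Finset.sum_le_sum fun e _ => hT e
    _ = _ := by simp

/-- The contribution of large coordinates to the pinned integral is small, uniformly in `N`. -/
theorem setLIntegral_boxWeight_cycleKernel_tail_le {V : Type*} [Fintype V] [DecidableEq V] {n : ℕ}
    (hn : 0 < n) (b : Fin n → V) (hb : Function.Surjective b) {N : ℕ} (hN : 0 < N) (M : ℝ≥0)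
    {δ R : ℝ} (hδ : 0 < δ) (hR : 2 * n * δ ≤ R) :
    ∫⁻ z in {z : V → ℝ | ∃ v, R < |z v|},
        (∏ v ∈ Finset.univ.erase (b ⟨0, hn⟩), boxWeight N M (z v)) * ‖cycleKernel N b z‖ₑ
        ∂pinnedVolume (b ⟨0, hn⟩) ≤
      n * ((Fintype.card V - 1 : ℕ) *
        ((M * ENNReal.ofReal (2 * Real.pi * (1 + n))) ^ (Fintype.card V - 1 - 1) *
        (M * ENNReal.ofReal
          (2 * (Real.pi ^ (1 + 1 / (n : ℝ)) * δ ^ (-(1 / (n : ℝ))) / (1 / (n : ℝ))))))) := by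
  choose u edge rank hrank hedge hinj using exists_spanning_tree hn b hb
  have hn' : (0 : ℝ) < n := by exact_mod_cast hn
  set o := b ⟨0, hn⟩ with ho
  set B : ℝ≥0∞ := M * ENNReal.ofReal (2 * Real.pi * (1 + n)) with hB
  set T : ℝ≥0∞ := M * ENNReal.ofReal
          (2 * (Real.pi ^ (1 + 1 / (n : ℝ)) * δ ^ (-(1 / (n : ℝ))) / (1 / (n : ℝ)))) with hT
  have hDm : Measurable fun w => ‖dirichletMean N w‖ₑ ^ (1 + 1 / (n : ℝ)) :=
    (continuous_dirichletMean N).measurable.enorm.pow_const _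
  have hTm := measurable_dirichletTail N (1 / (n : ℝ)) δ
  have hsub : Measurable fun p : ℝ × ℝ => p.1 - p.2 := measurable_fst.sub measurable_snd
  -- The truncated kernel sits on the edge of `v₀` only; the other edges keep the full kernel.
  -- Summing over `v₀` covers every choice of the long tree edge.
  set G : V → V → ℝ → ℝ≥0∞ := fun v₀ v w =>
    if v = v₀ then dirichletTail N (1 / (n : ℝ)) δ w
      else ‖dirichletMean N w‖ₑ ^ (1 + 1 / (n : ℝ)) with hG
  have hGm : ∀ v₀ v, Measurable (G v₀ v) := fun v₀ v => by
    rw [hG]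
    simp only
    split_ifs
    · exact hTm
    · exact hDm
  have hterm : ∀ e, ∀ v₀ ∈ Finset.univ.erase o, ∫⁻ z, ∏ v ∈ Finset.univ.erase o,
      (boxWeight N M (z v) * G v₀ v (z v - z (u e v))) ∂pinnedVolume o ≤
      B ^ (Fintype.card V - 1 - 1) * T := by
    intro e v₀ hv₀
    refine (lintegral_prod_tree_le o (by simp [pinnedFactor_self]) (u e) (rank e)
      (fun v hv => (hedge e v hv).1)
      (fun v z a => boxWeight N M z * G v₀ v (z - a))
      (fun v => ?_) (fun v => if v = v₀ then T else B) ?_).trans ?_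
    · exact ((measurable_boxWeight N M).comp measurable_fst).mul ((hGm v₀ v).comp hsub)
    · intro v hv a
      rw [pinnedFactor_of_ne hv, lintegral_boxWeight_mul N M (F := fun z => G v₀ v (z - a))
        ((hGm v₀ v).comp (measurable_id.sub_const a))]
      by_cases hvv : v = v₀
      · simp only [hG, hvv, if_true, hT]
        gcongr
        exact setLIntegral_dirichletTail_sub_le hN (by positivity) hδ a
      · simp only [hG, hvv, if_false, hB]
        gcongr
        have := setLIntegral_enorm_dirichletMean_sub_rpow_le hN (s := 1 / (n : ℝ))
          (by positivity) a
        simpa using this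
    · rw [← Finset.prod_erase_mul _ _ hv₀, if_pos rfl]
      refine le_of_eq (congrArg (· * T) ?_)
      rw [Finset.prod_congr rfl fun v hv => if_neg (Finset.ne_of_mem_erase hv),
        Finset.prod_const, Finset.card_erase_of_mem hv₀,
        Finset.card_erase_of_mem (Finset.mem_univ _), Finset.card_univ]
  have hset : MeasurableSet {z : V → ℝ | ∃ v, R < |z v|} := by
    have : {z : V → ℝ | ∃ v, R < |z v|} = ⋃ v, {z : V → ℝ | R < |z v|} := by
      ext z; simp
    rw [this]
    exact MeasurableSet.iUnion fun v =>
      measurableSet_lt measurable_const (measurable_pi_apply v).norm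
  calc _ ≤ ∫⁻ z, ∑ e, ∑ v₀ ∈ Finset.univ.erase o, ∏ v ∈ Finset.univ.erase o,
      (boxWeight N M (z v) * G v₀ v (z v - z (u e v))) ∂pinnedVolume o := by
        rw [← lintegral_indicator hset]
        refine lintegral_mono_ae ?_
        filter_upwards [ae_pinnedVolume_apply_eq_zero o] with z hzo
        by_cases hz : z ∈ {z : V → ℝ | ∃ v, R < |z v|}
        swap
        · rw [Set.indicator_of_notMem hz]
          exact zero_le
        rw [Set.indicator_of_mem hz]
        obtain ⟨w, hw⟩ := hz
        have hR0 : 0 ≤ R := (by positivity : (0 : ℝ) ≤ 2 * n * δ).trans hR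
        have hwo : w ≠ o := fun hh => by
          rw [hh, hzo, abs_zero] at hw
          linarith
        -- Beyond half a period the box weight at `w` vanishes.
        by_cases hwN : |z w| ≤ Real.pi * N
        swap
        · rw [Finset.prod_eq_zero (Finset.mem_erase.2 ⟨hwo, Finset.mem_univ w⟩), zero_mul]
          · exact zero_le
          · rw [boxWeight, Set.indicator_of_notMem]
            exact fun hh => hwN (abs_le.2 hh)
        simp only [Finset.prod_mul_distrib, ← Finset.mul_sum]
        gcongr
        refine (enorm_cycleKernel_le hn b u edge (fun e v hv => (hedge e v hv).2) hinj N z).trans ?_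
        refine Finset.sum_le_sum fun e _ => ?_
        obtain ⟨v₀, hv₀, hlt⟩ := exists_norm_sub_parent_gt (N := N) o (u e) (rank e)
          (fun v hv => (hedge e v hv).1) hzo hδ.le (hrank e) (by exact_mod_cast hR) hw hwN
        have hv₀' : v₀ ∈ Finset.univ.erase o := Finset.mem_erase.2 ⟨hv₀, Finset.mem_univ _⟩
        refine le_trans (le_of_eq ?_) (Finset.single_le_sum (f := fun v₀ =>
          ∏ v ∈ Finset.univ.erase o, G v₀ v (z v - z (u e v))) (fun _ _ => zero_le) hv₀')
        refine Finset.prod_congr rfl fun v _ => ?_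
        simp only [hG]
        split_ifs with hvv
        · rw [dirichletTail, Set.indicator_of_mem]
          rw [hvv]
          exact hlt
        · rfl
    _ = ∑ e, ∑ v₀ ∈ Finset.univ.erase o, ∫⁻ z, ∏ v ∈ Finset.univ.erase o,
      (boxWeight N M (z v) * G v₀ v (z v - z (u e v))) ∂pinnedVolume o := by
        have hm : ∀ e v₀, Measurable fun z : V → ℝ => ∏ v ∈ Finset.univ.erase o,
            (boxWeight N M (z v) * G v₀ v (z v - z (u e v))) := fun e v₀ =>
          Finset.measurable_fun_prod _ fun v _ =>
            ((measurable_boxWeight N M).comp (measurable_pi_apply v)).mul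
              ((hGm v₀ v).comp ((measurable_pi_apply v).sub (measurable_pi_apply _)))
        rw [lintegral_finsetSum _ fun e _ => Finset.measurable_fun_sum _ fun v₀ _ => hm e v₀]
        exact Finset.sum_congr rfl fun e _ => lintegral_finsetSum _ fun v₀ _ => hm e v₀
    _ ≤ ∑ _e : Fin n, ∑ _v₀ ∈ Finset.univ.erase o, B ^ (Fintype.card V - 1 - 1) * T :=
        Finset.sum_le_sum fun e _ => Finset.sum_le_sum fun v₀ hv₀ => hterm e v₀ hv₀
    _ = _ := by
        simp [Finset.card_erase_of_mem]

end RandomVandermonde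

namespace RandomVandermonde

/-! ### Convergence of integrals with uniformly small tails -/

/-- Dominated convergence is used only on the sets `B R` of finite measure, where the constant `C`
dominates. Uniformly small tails then make the full integrals Cauchy, without a global dominating
function or any integrability of `g`. -/
theorem exists_tendsto_integral_of_tight {Z : Type*} [MeasurableSpace Z] {μ : Measure Z}
    {f : ℕ → Z → ℂ} {g : Z → ℂ} (hf : ∀ᶠ N in atTop, Integrable (f N) μ)
    (hm : ∀ N, AEStronglyMeasurable (f N) μ)
    (hlim : ∀ z, Tendsto (fun N => f N z) atTop (𝓝 (g z))) {C : ℝ}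
    (hC : ∀ N z, ‖f N z‖ ≤ C) (B : ℝ → Set Z) (hBm : ∀ R, MeasurableSet (B R))
    (hB : ∀ R, μ (B R) < ∞)
    (htail : ∀ ε : ℝ, 0 < ε → ∃ R, ∀ᶠ N in atTop,
      ∫⁻ z in (B R)ᶜ, ‖f N z‖ₑ ∂μ ≤ ENNReal.ofReal ε) :
    ∃ l : ℂ, Tendsto (fun N => ∫ z, f N z ∂μ) atTop (𝓝 l) := by
  refine cauchySeq_tendsto_of_complete (Metric.cauchySeq_iff'.2 fun ε hε => ?_)
  obtain ⟨R, hR⟩ := htail (ε / 6) (by linarith)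
  have hconv : Tendsto (fun N => ∫ z in B R, f N z ∂μ) atTop (𝓝 (∫ z in B R, g z ∂μ)) := by
    refine tendsto_integral_of_dominated_convergence (fun _ => C)
      (fun N => (hm N).restrict) ?_ (fun N => Eventually.of_forall fun z => hC N z)
      (Eventually.of_forall fun z => hlim z)
    exact integrableOn_const (hB R).ne
  have hclose : ∀ᶠ N in atTop, dist (∫ z, f N z ∂μ) (∫ z in B R, g z ∂μ) < ε / 2 := by
    filter_upwards [hR, hf, Metric.tendsto_nhds.1 hconv (ε / 6) (by linarith)] with N h1 h2 h3
    rw [← integral_add_compl (hBm R) h2]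
    have h4 : ‖∫ z in (B R)ᶜ, f N z ∂μ‖ ≤ ε / 6 := by
      have h5 := enorm_integral_le_lintegral_enorm (μ := μ.restrict (B R)ᶜ) (f N)
      have h6 := h5.trans h1
      rwa [← ofReal_norm, ENNReal.ofReal_le_ofReal_iff (by linarith)] at h6
    calc _ ≤ dist (∫ z in B R, f N z ∂μ) (∫ z in B R, g z ∂μ) + ‖∫ z in (B R)ᶜ, f N z ∂μ‖ := by
          rw [dist_eq_norm, dist_eq_norm, add_sub_right_comm]
          exact norm_add_le _ _
      _ < ε / 2 := by linarith
  obtain ⟨N₀, hN₀⟩ := eventually_atTop.1 hclose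
  refine ⟨N₀, fun N hN => ?_⟩
  calc _ ≤ _ + dist (∫ z in B R, g z ∂μ) (∫ z, f N₀ z ∂μ) := dist_triangle _ _ _
    _ < ε / 2 + ε / 2 := by
      refine add_lt_add (hN₀ N hN) ?_
      rw [dist_comm]
      exact hN₀ N₀ le_rfl
    _ = ε := by ring

/-! ### The pinned integrals -/

/-- The density `t ↦ P(x + t / N)`, cut to `[-πN, πN]`. -/
noncomputable def boxDensity (P : ℝ → ℝ) (x : ℝ) (N : ℕ) (t : ℝ) : ℝ :=
  (Set.Icc (-(Real.pi * N)) (Real.pi * N)).indicator (fun t => P (x + t / N)) t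

theorem measurable_boxDensity {P : ℝ → ℝ} (hP : Measurable P) (x : ℝ) (N : ℕ) :
    Measurable (boxDensity P x N) :=
  (hP.comp (measurable_const.add (measurable_id.div_const _))).indicator measurableSet_Icc

theorem enorm_boxDensity_le {P : ℝ → ℝ} {M : ℝ≥0} (hPM : ∀ y, |P y| ≤ M) (x : ℝ) (N : ℕ) (t : ℝ) :
    ‖(boxDensity P x N t : ℂ)‖ₑ ≤ boxWeight N M t := by
  rw [boxDensity, boxWeight]
  by_cases ht : t ∈ Set.Icc (-(Real.pi * N)) (Real.pi * N)
  · rw [Set.indicator_of_mem ht, Set.indicator_of_mem ht, ← ofReal_norm, Complex.norm_real,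
      Real.norm_eq_abs, ← ENNReal.ofReal_coe_nnreal]
    exact ENNReal.ofReal_le_ofReal (hPM _)
  · simp [Set.indicator_of_notMem ht]

theorem norm_boxDensity_le {P : ℝ → ℝ} {M : ℝ≥0} (hPM : ∀ y, |P y| ≤ M) (x : ℝ) (N : ℕ) (t : ℝ) :
    ‖(boxDensity P x N t : ℂ)‖ ≤ M := by
  rw [Complex.norm_real, Real.norm_eq_abs, boxDensity, Set.indicator]
  split_ifs
  · exact hPM _
  · simp

theorem integrable_boxDensity {P : ℝ → ℝ} {M : ℝ≥0} (hP : Measurable P) (hPM : ∀ y, |P y| ≤ M)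
    (x : ℝ) (N : ℕ) : Integrable (fun t => (boxDensity P x N t : ℂ)) := by
  refine ⟨(Complex.measurable_ofReal.comp (measurable_boxDensity hP x N)).aestronglyMeasurable, ?_⟩
  refine (lintegral_mono fun t => enorm_boxDensity_le hPM x N t).trans_lt ?_
  simp only [boxWeight]
  rw [lintegral_indicator measurableSet_Icc]
  simp only [lintegral_const, MeasurableSet.univ, Measure.restrict_apply, Set.univ_inter,
    Real.volume_Icc]
  exact ENNReal.mul_lt_top ENNReal.coe_lt_top ENNReal.ofReal_lt_top

theorem tendsto_boxDensity {P : ℝ → ℝ} {x : ℝ} (hx : ContinuousAt P x) (t : ℝ) :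
    Tendsto (fun N => boxDensity P x N t) atTop (𝓝 (P x)) := by
  have hlarge : ∀ᶠ N : ℕ in atTop, |t| ≤ Real.pi * N :=
    (tendsto_natCast_atTop_atTop.const_mul_atTop Real.pi_pos).eventually_ge_atTop _
  have h1 : Tendsto (fun N : ℕ => x + t / N) atTop (𝓝 x) := by
    simpa using (tendsto_const_nhds (x := x)).add (tendsto_const_div_atTop_nhds_zero_nat t)
  refine (hx.tendsto.comp h1).congr' ?_
  filter_upwards [hlarge] with N hN
  rw [boxDensity, Set.indicator_of_mem (show t ∈ Set.Icc _ _ from abs_le.1 hN)]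
  rfl

/-- The product of cut densities and of kernels along a cyclic walk. -/
noncomputable def pinnedIntegrand {V : Type*} [Fintype V] [DecidableEq V] {n : ℕ} (P : ℝ → ℝ)
    (b : Fin n → V) (o : V) (x : ℝ) (N : ℕ) (z : V → ℝ) : ℂ :=
  (∏ v ∈ Finset.univ.erase o, (boxDensity P x N (z v) : ℂ)) * cycleKernel N b z

section PinnedIntegrand

variable {V : Type*} [Fintype V] [DecidableEq V] {n : ℕ} {P : ℝ → ℝ} {M : ℝ≥0}

theorem measurable_pinnedIntegrand (hP : Measurable P) (b : Fin n → V) (o : V) (x : ℝ) (N : ℕ) :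
    Measurable (pinnedIntegrand P b o x N) :=
  (Finset.measurable_fun_prod _ fun v _ => Complex.measurable_ofReal.comp
    ((measurable_boxDensity hP x N).comp (measurable_pi_apply v))).mul
    (continuous_cycleKernel N b).measurable

theorem enorm_pinnedIntegrand_le (hPM : ∀ y, |P y| ≤ M) (b : Fin n → V) (o : V) (x : ℝ) (N : ℕ)
    (z : V → ℝ) :
    ‖pinnedIntegrand P b o x N z‖ₑ ≤
      (∏ v ∈ Finset.univ.erase o, boxWeight N M (z v)) * ‖cycleKernel N b z‖ₑ := by
  rw [pinnedIntegrand, enorm_mul]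
  gcongr
  rw [← ofReal_norm, norm_prod, ENNReal.ofReal_prod_of_nonneg fun _ _ => norm_nonneg _]
  refine Finset.prod_le_prod' fun v _ => ?_
  rw [ofReal_norm]
  exact enorm_boxDensity_le hPM x N (z v)

theorem norm_pinnedIntegrand_le (hPM : ∀ y, |P y| ≤ M) (b : Fin n → V) (o : V) (x : ℝ) (N : ℕ)
    (z : V → ℝ) : ‖pinnedIntegrand P b o x N z‖ ≤ (M : ℝ) ^ (Fintype.card V - 1) := by
  rw [pinnedIntegrand, norm_mul, norm_prod]
  calc _ ≤ (∏ _v ∈ Finset.univ.erase o, (M : ℝ)) * 1 := by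
        gcongr
        · exact norm_boxDensity_le hPM x N _
        · exact norm_cycleKernel_le_one N b z
    _ = _ := by
      rw [mul_one, Finset.prod_const, Finset.card_erase_of_mem (Finset.mem_univ _),
        Finset.card_univ]

theorem lintegral_enorm_pinnedIntegrand_le (hPM : ∀ y, |P y| ≤ M) (hn : 0 < n) (b : Fin n → V)
    (hb : Function.Surjective b) (x : ℝ) {N : ℕ} (hN : 0 < N) :
    ∫⁻ z, ‖pinnedIntegrand P b (b ⟨0, hn⟩) x N z‖ₑ ∂pinnedVolume (b ⟨0, hn⟩) ≤
      ENNReal.ofReal (n * (M * (2 * Real.pi * (1 + n))) ^ (Fintype.card V - 1)) := by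
  refine (lintegral_mono fun z => enorm_pinnedIntegrand_le hPM b _ x N z).trans ?_
  refine (lintegral_boxWeight_cycleKernel_le hn b hb hN M).trans (le_of_eq ?_)
  have := Real.pi_pos
  rw [ENNReal.ofReal_mul (p := (n : ℝ)) (by positivity), ENNReal.ofReal_pow (by positivity),
    ENNReal.ofReal_mul (p := (M : ℝ)) (by positivity), ENNReal.ofReal_coe_nnreal, ENNReal.ofReal_natCast]

theorem integrable_pinnedIntegrand (hP : Measurable P) (hPM : ∀ y, |P y| ≤ M) (hn : 0 < n)
    (b : Fin n → V) (hb : Function.Surjective b) (x : ℝ) {N : ℕ} (hN : 0 < N) :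
    Integrable (pinnedIntegrand P b (b ⟨0, hn⟩) x N) (pinnedVolume (b ⟨0, hn⟩)) :=
  ⟨(measurable_pinnedIntegrand hP b _ x N).aestronglyMeasurable,
    (lintegral_enorm_pinnedIntegrand_le hPM hn b hb x hN).trans_lt ENNReal.ofReal_lt_top⟩

theorem norm_integral_pinnedIntegrand_le (hPM : ∀ y, |P y| ≤ M) (hn : 0 < n) (b : Fin n → V)
    (hb : Function.Surjective b) (x : ℝ) {N : ℕ} (hN : 0 < N) :
    ‖∫ z, pinnedIntegrand P b (b ⟨0, hn⟩) x N z ∂pinnedVolume (b ⟨0, hn⟩)‖ ≤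
      n * (M * (2 * Real.pi * (1 + n))) ^ (Fintype.card V - 1) := by
  have h := (enorm_integral_le_lintegral_enorm _).trans
    (lintegral_enorm_pinnedIntegrand_le hPM hn b hb x hN)
  have := Real.pi_pos
  rwa [← ofReal_norm, ENNReal.ofReal_le_ofReal_iff (by positivity)] at h

theorem exists_tendsto_integral_pinnedIntegrand (hP : Measurable P) (hPM : ∀ y, |P y| ≤ M)
    (hn : 0 < n) (b : Fin n → V) (hb : Function.Surjective b) {x : ℝ} (hx : ContinuousAt P x) :
    ∃ l : ℂ, Tendsto (fun N => ∫ z, pinnedIntegrand P b (b ⟨0, hn⟩) x N z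
      ∂pinnedVolume (b ⟨0, hn⟩)) atTop (𝓝 l) := by
  choose D hD using exists_tendsto_dirichletMean
  set o := b ⟨0, hn⟩ with ho
  have hn' : (0 : ℝ) < n := by exact_mod_cast hn
  have hset : ∀ R : ℝ, MeasurableSet {z : V → ℝ | ∀ v, |z v| ≤ R} := fun R => by
    have : {z : V → ℝ | ∀ v, |z v| ≤ R} = ⋂ v, {z : V → ℝ | |z v| ≤ R} := by
      ext z; simp
    rw [this]
    exact MeasurableSet.iInter fun v =>
      measurableSet_le (measurable_pi_apply v).norm measurable_const
  refine exists_tendsto_integral_of_tight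
    (g := fun z => (∏ v ∈ Finset.univ.erase o, (P x : ℂ)) *
      ∏ k, D (z (b (finRotate n k)) - z (b k)))
    ?_ (fun N => (measurable_pinnedIntegrand hP b o x N).aestronglyMeasurable) ?_
    (norm_pinnedIntegrand_le hPM b o x) (fun R => {z : V → ℝ | ∀ v, |z v| ≤ R}) hset ?_ ?_
  · filter_upwards [eventually_gt_atTop 0] with N hN
    exact integrable_pinnedIntegrand hP hPM hn b hb x hN
  · intro z
    refine Tendsto.mul (tendsto_finsetProd _ fun v _ => ?_) (tendsto_finsetProd _ fun k _ => hD _)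
    exact (Complex.continuous_ofReal.tendsto _).comp (tendsto_boxDensity hx (z v))
  · intro R
    refine lt_of_le_of_lt (measure_mono ?_)
      ((isCompact_univ_pi fun _ : V => isCompact_Icc (a := -R) (b := R)).measure_lt_top)
    intro z hz v _
    exact abs_le.1 (hz v)
  · intro ε hε
    set A : ℝ≥0∞ := (M * ENNReal.ofReal (2 * Real.pi * (1 + n))) ^ (Fintype.card V - 1 - 1) with hA
    have hAtop : A ≠ ∞ := ENNReal.pow_ne_top (ENNReal.mul_ne_top ENNReal.coe_ne_top
      ENNReal.ofReal_ne_top)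
    -- The tail bound is a constant times `δ^{-1/n}`, hence tends to `0` as `δ` grows.
    have htend : Tendsto (fun δ : ℝ => (n : ℝ≥0∞) * ((Fintype.card V - 1 : ℕ) * (A *
        (M * ENNReal.ofReal
          (2 * (Real.pi ^ (1 + 1 / (n : ℝ)) * δ ^ (-(1 / (n : ℝ))) / (1 / (n : ℝ)))))))) atTop
        (𝓝 (n * ((Fintype.card V - 1 : ℕ) * (A * (M * ENNReal.ofReal
          (2 * (Real.pi ^ (1 + 1 / (n : ℝ)) * 0 / (1 / (n : ℝ))))))))) := by
      refine ENNReal.Tendsto.const_mul ?_ (Or.inr (ENNReal.natCast_ne_top _))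
      refine ENNReal.Tendsto.const_mul ?_ (Or.inr (ENNReal.natCast_ne_top _))
      refine ENNReal.Tendsto.const_mul ?_ (Or.inr hAtop)
      refine ENNReal.Tendsto.const_mul ?_ (Or.inr ENNReal.coe_ne_top)
      refine ENNReal.tendsto_ofReal ?_
      exact (((tendsto_rpow_neg_atTop (by positivity)).const_mul _).div_const _).const_mul _
    simp only [mul_zero, zero_div, ENNReal.ofReal_zero] at htend
    obtain ⟨δ, hδε, hδ⟩ := ((htend.eventually_lt_const (ENNReal.ofReal_pos.2 hε)).and
      (eventually_gt_atTop 0)).exists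
    -- The ranks in the spanning trees are at most `2n`, so a coordinate beyond `2nδ` forces a tree
    -- difference beyond `δ`.
    refine ⟨2 * n * δ, ?_⟩
    filter_upwards [eventually_gt_atTop 0] with N hN
    have hcompl : {z : V → ℝ | ∀ v, |z v| ≤ 2 * n * δ}ᶜ =
        {z : V → ℝ | ∃ v, 2 * n * δ < |z v|} := by
      ext z; simp
    rw [hcompl]
    refine le_trans ?_ hδε.le
    refine le_trans (lintegral_mono fun z => enorm_pinnedIntegrand_le hPM b _ x N z) ?_
    exact setLIntegral_boxWeight_cycleKernel_tail_le hn b hb hN M hδ le_rfl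

end PinnedIntegrand

end RandomVandermonde

namespace RandomVandermonde

/-! ### The pinned integral as a sum of products of Fourier coefficients -/

/-- The exponent attached to the vertex `v` of the walk `b`. -/
def walkExponent {V : Type*} [DecidableEq V] {n N : ℕ} (b : Fin n → V) (i : Fin n → Fin N)
    (v : V) : ℤ :=
  blockExponent i (Finset.univ.filter fun k => b k = v)

/-- Summation by parts around the cycle: the terms are regrouped by vertex, then the index of one
half is rotated. -/
theorem sum_walkExponent_mul {V : Type*} [Fintype V] [DecidableEq V] {n N : ℕ} (b : Fin n → V)
    (i : Fin n → Fin N) (z : V → ℝ) :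
    ∑ v, (walkExponent b i v : ℝ) * z v =
      ∑ k, ((i k : ℕ) : ℝ) * (z (b (finRotate n k)) - z (b k)) := by
  have h1 : ∑ v, (walkExponent b i v : ℝ) * z v =
      ∑ k, ((((i ((finRotate n).symm k) : ℕ) : ℝ)) - ((i k : ℕ) : ℝ)) * z (b k) := by
    rw [← Finset.sum_fiberwise_of_maps_to (s := Finset.univ) (t := Finset.univ) (g := b)
      fun _ _ => Finset.mem_univ _]
    refine Finset.sum_congr rfl fun v _ => ?_
    rw [walkExponent, blockExponent]
    push_cast
    rw [Finset.sum_mul]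
    refine Finset.sum_congr rfl fun k hk => ?_
    rw [(Finset.mem_filter.1 hk).2]
  rw [h1]
  simp only [sub_mul, mul_sub, Finset.sum_sub_distrib]
  congr 1
  rw [← Equiv.sum_comp (finRotate n)]
  simp only [Equiv.symm_apply_apply]

/-- The case of constant `z`, where every difference vanishes. This translation invariance lets one
vertex be pinned at the base point. -/
theorem sum_walkExponent {V : Type*} [Fintype V] [DecidableEq V] {n N : ℕ} (b : Fin n → V)
    (i : Fin n → Fin N) : ∑ v, walkExponent b i v = 0 := by
  have h := sum_walkExponent_mul b i fun _ => 1
  simp only [mul_one, sub_self, mul_zero, Finset.sum_const_zero] at h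
  exact_mod_cast h

/-- Expanding the product of sums gives one exponential per `i`, and summation by parts separates
its exponent over the vertices. Fubini can then be applied coordinatewise. -/
theorem cycleKernel_eq_sum {V : Type*} [Fintype V] [DecidableEq V] {n : ℕ} (N : ℕ)
    (b : Fin n → V) (z : V → ℝ) :
    cycleKernel N b z = ((N : ℂ)⁻¹) ^ n * ∑ i : Fin n → Fin N, ∏ v,
      Complex.exp (Complex.I * (walkExponent b i v : ℂ) * ((z v / N : ℝ) : ℂ)) := by
  rw [cycleKernel]
  simp only [dirichletMean, Finset.prod_mul_distrib, Finset.prod_const, Finset.card_univ,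
    Fintype.card_fin]
  rw [Finset.prod_univ_sum, Fintype.piFinset_univ]
  congr 1
  refine Finset.sum_congr rfl fun i _ => ?_
  rw [← Complex.exp_sum, ← Complex.exp_sum]
  congr 1
  have h := congrArg (fun r : ℝ => Complex.I * ((r / N : ℝ) : ℂ)) (sum_walkExponent_mul b i z)
  calc _ = Complex.I * (((∑ k, ((i k : ℕ) : ℝ) * (z (b (finRotate n k)) - z (b k))) / N : ℝ) : ℂ) := by
        push_cast
        rw [Finset.sum_div, Finset.mul_sum]
        exact Finset.sum_congr rfl fun k _ => by ring
    _ = Complex.I * (((∑ v, (walkExponent b i v : ℝ) * z v) / N : ℝ) : ℂ) := h.symm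
    _ = _ := by
        push_cast
        rw [Finset.sum_div, Finset.mul_sum]
        exact Finset.sum_congr rfl fun k _ => by ring

/-- The Fourier coefficient of a density on `[-π, π]`. -/
noncomputable def densityFourier (P : ℝ → ℝ) (m : ℤ) : ℂ :=
  ∫ x in (-Real.pi)..Real.pi, (P x : ℂ) * Complex.exp (Complex.I * (m : ℂ) * (x : ℂ))

/-- The substitution `y = x + t/N` has Jacobian `N` and maps the box onto the period centred at `x`;
periodicity moves that period back to `[-π, π]`. -/
theorem integral_boxDensity_mul_exp {P : ℝ → ℝ} (hper : Function.Periodic P (2 * Real.pi)) (x : ℝ)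
    {N : ℕ} (hN : 0 < N) (m : ℤ) :
    ∫ t, (boxDensity P x N t : ℂ) * Complex.exp (Complex.I * (m : ℂ) * ((t / N : ℝ) : ℂ)) =
      N * (Complex.exp (-(Complex.I * (m : ℂ) * (x : ℂ))) * densityFourier P m) := by
  have hN' : (N : ℝ) ≠ 0 := by exact_mod_cast hN.ne'
  have hpi := Real.pi_pos
  have hNp : (0 : ℝ) < N := by exact_mod_cast hN
  set F : ℝ → ℂ := fun y => (P y : ℂ) * Complex.exp (Complex.I * (m : ℂ) * (y : ℂ)) with hF
  have hFper : Function.Periodic F (2 * Real.pi) := by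
    intro y
    simp only [hF]
    rw [hper y]
    congr 1
    rw [Complex.ofReal_add, mul_add, Complex.exp_add]
    have : Complex.I * (m : ℂ) * ((2 * Real.pi : ℝ) : ℂ) = m * (2 * Real.pi * Complex.I) := by
      push_cast; ring
    rw [this, Complex.exp_int_mul_two_pi_mul_I, mul_one]
  calc _ = ∫ t in (-(Real.pi * N))..(Real.pi * N),
        Complex.exp (-(Complex.I * (m : ℂ) * (x : ℂ))) * F (x + t / N) := by
        rw [intervalIntegral.integral_of_le (by nlinarith), restrict_Ioc_eq_restrict_Icc,
          ← integral_indicator measurableSet_Icc]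
        congr 1
        ext t
        rw [boxDensity]
        by_cases ht : t ∈ Set.Icc (-(Real.pi * N)) (Real.pi * N)
        · rw [Set.indicator_of_mem ht, Set.indicator_of_mem ht, hF]
          simp only
          rw [mul_left_comm, ← Complex.exp_add]
          congr 2
          push_cast
          ring
        · simp [Set.indicator_of_notMem ht]
    _ = Complex.exp (-(Complex.I * (m : ℂ) * (x : ℂ))) *
          ((N : ℝ) • ∫ y in (x - Real.pi)..(x - Real.pi + 2 * Real.pi), F y) := by
        rw [intervalIntegral.integral_const_mul, intervalIntegral.integral_comp_add_div _ hN']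
        congr 3
        · field_simp
          ring
        · field_simp
          ring
    _ = _ := by
        rw [hFper.intervalIntegral_add_eq (x - Real.pi) (-Real.pi), densityFourier,
          show -Real.pi + 2 * Real.pi = Real.pi by ring, Complex.real_smul, Complex.ofReal_natCast]
        ring

theorem integral_pinnedIntegrand_eq {V : Type*} [Fintype V] [DecidableEq V] {n : ℕ} {P : ℝ → ℝ}
    {M : ℝ≥0} (hP : Measurable P) (hPM : ∀ y, |P y| ≤ M)
    (hper : Function.Periodic P (2 * Real.pi)) (b : Fin n → V) (o : V) (x : ℝ) {N : ℕ}
    (hN : 0 < N) :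
    ∫ z, pinnedIntegrand P b o x N z ∂pinnedVolume o =
      (N : ℂ) ^ (Fintype.card V - 1) / (N : ℂ) ^ n *
        ∑ i : Fin n → Fin N, ∏ v ∈ Finset.univ.erase o,
          (Complex.exp (-(Complex.I * (walkExponent b i v : ℂ) * (x : ℂ))) *
            densityFourier P (walkExponent b i v)) := by
  -- The root carries no density; its variable is evaluated at `0` by the Dirac factor and
  -- contributes `1`. Every other vertex contributes a factor `N`.
  set g : (Fin n → Fin N) → V → ℝ → ℂ := fun i v t =>
    (if v = o then 1 else (boxDensity P x N t : ℂ)) *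
      Complex.exp (Complex.I * (walkExponent b i v : ℂ) * ((t / N : ℝ) : ℂ)) with hg
  have hnorm : ∀ (m : ℤ) (t : ℝ),
      ‖Complex.exp (Complex.I * (m : ℂ) * ((t / N : ℝ) : ℂ))‖ = 1 := fun m t => by
    rw [show Complex.I * (m : ℂ) * ((t / N : ℝ) : ℂ) = ((m * (t / N) : ℝ) : ℂ) * Complex.I by
      push_cast; ring, Complex.norm_exp_ofReal_mul_I]
  have hexp : ∀ m : ℤ, Continuous fun t : ℝ =>
      Complex.exp (Complex.I * (m : ℂ) * ((t / N : ℝ) : ℂ)) := fun m => by fun_prop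
  have hint : ∀ i v, Integrable (g i v) (pinnedFactor o v) := by
    intro i v
    by_cases hv : v = o
    · subst hv
      simp only [hg, if_true, one_mul, pinnedFactor_self]
      exact Integrable.of_bound (hexp _).aestronglyMeasurable 1
        (Eventually.of_forall fun t => (hnorm _ t).le)
    · simp only [hg, hv, if_false, pinnedFactor_of_ne hv]
      exact (integrable_boxDensity hP hPM x N).mul_bdd (c := 1) (hexp _).aestronglyMeasurable
        (Eventually.of_forall fun t => (hnorm _ t).le)
  have hpoint : ∀ z : V → ℝ, pinnedIntegrand P b o x N z =
      ((N : ℂ)⁻¹) ^ n * ∑ i : Fin n → Fin N, ∏ v, g i v (z v) := by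
    intro z
    rw [pinnedIntegrand, cycleKernel_eq_sum, mul_left_comm, Finset.mul_sum]
    congr 1
    refine Finset.sum_congr rfl fun i _ => ?_
    simp only [hg, Finset.prod_mul_distrib]
    congr 1
    rw [← Finset.mul_prod_erase _ _ (Finset.mem_univ o), if_pos rfl, one_mul]
    exact Finset.prod_congr rfl fun v hv => (if_neg (Finset.ne_of_mem_erase hv)).symm
  simp only [hpoint]
  rw [integral_const_mul, pinnedVolume, integral_finsetSum _ fun i _ =>
    Integrable.fintype_prod_dep fun v => hint i v]
  rw [Finset.mul_sum, Finset.mul_sum]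
  refine Finset.sum_congr rfl fun i _ => ?_
  rw [integral_fintype_prod_eq_prod, ← Finset.mul_prod_erase _ _ (Finset.mem_univ o)]
  have ho : ∫ t, g i o t ∂pinnedFactor o o = 1 := by
    rw [pinnedFactor_self, integral_dirac]
    simp [hg]
  have hv : ∀ v ∈ Finset.univ.erase o, ∫ t, g i v t ∂pinnedFactor o v =
      N * (Complex.exp (-(Complex.I * (walkExponent b i v : ℂ) * (x : ℂ))) *
            densityFourier P (walkExponent b i v)) := by
    intro v hv
    have hv := Finset.ne_of_mem_erase hv
    simp only [hg, hv, if_false, pinnedFactor_of_ne hv]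
    exact integral_boxDensity_mul_exp hper x hN _
  rw [ho, Finset.prod_congr rfl hv, one_mul]
  simp only [Finset.prod_mul_distrib, Finset.prod_const, Finset.card_erase_of_mem (Finset.mem_univ o), Finset.card_univ]
  rw [inv_pow, div_eq_mul_inv]
  ring

end RandomVandermonde

namespace RandomVandermonde

/-! ### The periodic extension of a density -/

/-- The `2π`-periodic extension of the restriction of `p` to `[-π, π)`. -/
noncomputable def periodicExtension (p : ℝ → ℝ) (x : ℝ) : ℝ :=
  (Set.Icc (-Real.pi) Real.pi).indicator p
    (2 * Real.pi * Int.fract ((x + Real.pi) / (2 * Real.pi)) - Real.pi)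

theorem periodicExtension_periodic (p : ℝ → ℝ) :
    Function.Periodic (periodicExtension p) (2 * Real.pi) := by
  intro x
  have hpi := Real.pi_pos
  have : (x + 2 * Real.pi + Real.pi) / (2 * Real.pi) = (x + Real.pi) / (2 * Real.pi) + 1 := by
    field_simp
    ring
  rw [periodicExtension, periodicExtension, this, Int.fract_add_one]

/-- Nothing is known of `p` outside `[-π, π]`. The indicator in `periodicExtension` is only ever
evaluated inside that interval, and turns continuity there into measurability on the line. -/
theorem measurable_periodicExtension {p : ℝ → ℝ}
    (hp : ContinuousOn p (Set.Icc (-Real.pi) Real.pi)) : Measurable (periodicExtension p) := by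
  classical
  have h : Measurable ((Set.Icc (-Real.pi) Real.pi).indicator p) := by
    rw [← Set.piecewise_eq_indicator]
    exact hp.measurable_piecewise continuousOn_const measurableSet_Icc
  refine h.comp ((Measurable.const_mul ?_ _).sub_const _)
  exact measurable_fract.comp ((measurable_id.add_const _).div_const _)

theorem periodicExtension_eq (p : ℝ → ℝ) {x : ℝ} (hx : x ∈ Set.Ico (-Real.pi) Real.pi) :
    periodicExtension p x = p x := by
  have hpi := Real.pi_pos
  have h1 : Int.fract ((x + Real.pi) / (2 * Real.pi)) = (x + Real.pi) / (2 * Real.pi) := by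
    rw [Int.fract_eq_self]
    refine ⟨div_nonneg (by linarith [hx.1]) (by linarith), ?_⟩
    rw [div_lt_one (by linarith)]
    linarith [hx.2]
  have h2 : 2 * Real.pi * ((x + Real.pi) / (2 * Real.pi)) - Real.pi = x := by
    field_simp
    ring
  rw [periodicExtension, h1, h2, Set.indicator_of_mem (Set.Ico_subset_Icc_self hx)]

/-- The endpoints are excluded because `p (-π)` and `p π` may differ and the extension may jump
there; `ν` does not charge them. -/
theorem continuousAt_periodicExtension {p : ℝ → ℝ}
    (hp : ContinuousOn p (Set.Icc (-Real.pi) Real.pi)) {x : ℝ}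
    (hx : x ∈ Set.Ioo (-Real.pi) Real.pi) : ContinuousAt (periodicExtension p) x := by
  refine (hp.continuousAt (Icc_mem_nhds hx.1 hx.2)).congr ?_
  filter_upwards [Ioo_mem_nhds hx.1 hx.2] with y hy
  exact (periodicExtension_eq p (Set.Ioo_subset_Ico_self hy)).symm

theorem exists_abs_periodicExtension_le {p : ℝ → ℝ}
    (hp : ContinuousOn p (Set.Icc (-Real.pi) Real.pi)) :
    ∃ M : ℝ≥0, ∀ x, |periodicExtension p x| ≤ M := by
  obtain ⟨C, hC⟩ := isCompact_Icc.exists_bound_of_continuousOn hp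
  refine ⟨⟨max C 0, le_max_right _ _⟩, fun x => ?_⟩
  rw [periodicExtension, Set.indicator]
  split_ifs with h
  · exact (hC _ h).trans (le_max_left _ _)
  · rw [abs_zero]
    exact NNReal.coe_nonneg _

theorem phaseFourier_eq_densityFourier {ν : Measure ℝ} {p : ℝ → ℝ}
    (hp_cont : ContinuousOn p (Set.Icc (-Real.pi) Real.pi))
    (hp_nonneg : ∀ x ∈ Set.Icc (-Real.pi) Real.pi, 0 ≤ p x)
    (hν : ν = (volume.restrict (Set.Icc (-Real.pi) Real.pi)).withDensity
      fun x => ENNReal.ofReal (p x)) (m : ℤ) :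
    phaseFourier ν m = densityFourier (periodicExtension p) m := by
  have hpi := Real.pi_pos
  rw [phaseFourier, hν, integral_withDensity_eq_integral_toReal_smul₀
    (hp_cont.aemeasurable measurableSet_Icc).ennreal_ofReal
    (Eventually.of_forall fun _ => ENNReal.ofReal_lt_top), densityFourier,
    intervalIntegral.integral_of_le (by linarith), ← integral_Ico_eq_integral_Ioc,
    integral_Icc_eq_integral_Ico]
  refine setIntegral_congr_fun measurableSet_Ico fun x hx => ?_
  rw [periodicExtension_eq p hx, ENNReal.toReal_ofReal (hp_nonneg x (Set.Ico_subset_Icc_self hx)),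
    Complex.real_smul]

theorem ae_mem_Ioo {ν : Measure ℝ} {p : ℝ → ℝ}
    (hν : ν = (volume.restrict (Set.Icc (-Real.pi) Real.pi)).withDensity
      fun x => ENNReal.ofReal (p x)) : ∀ᵐ x ∂ν, x ∈ Set.Ioo (-Real.pi) Real.pi := by
  rw [hν]
  refine (withDensity_absolutelyContinuous _ _).ae_le ?_
  rw [← restrict_Ioo_eq_restrict_Icc]
  exact ae_restrict_mem measurableSet_Ioo

/-! ### Existence of the limit coefficients -/

/-- The block of a partition that contains a given index. -/
def blockOf {n : ℕ} (ρ : Finpartition (Finset.univ : Finset (Fin n))) (k : Fin n) : ρ.parts :=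
  ⟨ρ.part k, ρ.part_mem.2 (Finset.mem_univ k)⟩

theorem blockOf_eq_iff {n : ℕ} (ρ : Finpartition (Finset.univ : Finset (Fin n))) (k : Fin n)
    (B : ρ.parts) : blockOf ρ k = B ↔ k ∈ B.1 := by
  rw [Subtype.ext_iff]
  exact ρ.part_eq_iff_mem B.2

theorem blockOf_surjective {n : ℕ} (ρ : Finpartition (Finset.univ : Finset (Fin n))) :
    Function.Surjective (blockOf ρ) := by
  intro B
  obtain ⟨k, hk⟩ := ρ.nonempty_of_mem_parts B.2
  exact ⟨k, (blockOf_eq_iff ρ k B).2 hk⟩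

theorem walkExponent_blockOf {n N : ℕ} (ρ : Finpartition (Finset.univ : Finset (Fin n)))
    (i : Fin n → Fin N) (B : ρ.parts) : walkExponent (blockOf ρ) i B = blockExponent i B.1 := by
  rw [walkExponent]
  congr 1
  ext k
  simp [blockOf_eq_iff]

theorem continuous_prod_exp_mul {V : Type*} (s : Finset V) (E : V → ℤ) (φ : V → ℂ) :
    Continuous fun x : ℝ =>
      ∏ v ∈ s, (Complex.exp (-(Complex.I * (E v : ℂ) * (x : ℂ))) * φ v) := by
  fun_prop

/-- As the exponents sum to zero, the phases in `x` of the vertices other than `o` combine to `e^{i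
E_o x}`. Integrating over the base point restores the missing Fourier coefficient. -/
theorem integral_prod_exp_mul {V : Type*} [Fintype V] [DecidableEq V] (ν : Measure ℝ) (o : V)
    (E : V → ℤ) (hE : ∑ v, E v = 0) (φ : V → ℂ) :
    ∫ x : ℝ, ∏ v ∈ Finset.univ.erase o,
        (Complex.exp (-(Complex.I * (E v : ℂ) * (x : ℂ))) * φ v) ∂ν =
      phaseFourier ν (E o) * ∏ v ∈ Finset.univ.erase o, φ v := by
  rw [phaseFourier, ← integral_mul_const]
  congr 1
  ext x
  rw [Finset.prod_mul_distrib, ← Complex.exp_sum]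
  congr 2
  have h : (∑ v ∈ Finset.univ.erase o, (E v : ℂ)) = -(E o : ℂ) := by
    rw [eq_neg_iff_add_eq_zero, Finset.sum_erase_add _ _ (Finset.mem_univ o)]
    exact_mod_cast hE
  rw [Finset.sum_neg_distrib, ← Finset.sum_mul, ← Finset.mul_sum, h]
  ring

variable {ν : Measure ℝ} [IsProbabilityMeasure ν] {P : ℝ → ℝ} {M : ℝ≥0} {n : ℕ}

theorem continuous_integral_pinnedIntegrand {V : Type*} [Fintype V] [DecidableEq V]
    (hP : Measurable P) (hPM : ∀ y, |P y| ≤ M)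
    (hper : Function.Periodic P (2 * Real.pi)) (b : Fin n → V) (o : V) {N : ℕ} (hN : 0 < N) :
    Continuous fun x => ∫ z, pinnedIntegrand P b o x N z ∂pinnedVolume o := by
  simp only [integral_pinnedIntegrand_eq hP hPM hper b o _ hN]
  exact continuous_const.mul (continuous_finsetSum _ fun i _ => continuous_prod_exp_mul _ _ _)

theorem expansionCoeffN_eq_integral (hP : Measurable P) (hPM : ∀ y, |P y| ≤ M)
    (hper : Function.Periodic P (2 * Real.pi))
    (hfour : ∀ m, phaseFourier ν m = densityFourier P m)
    (ρ : Finpartition (Finset.univ : Finset (Fin n))) (o : ρ.parts) {N : ℕ} (hN : 0 < N) :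
    expansionCoeffN ν ρ N =
      ∫ x, ∫ z, pinnedIntegrand P (blockOf ρ) o x N z ∂pinnedVolume o ∂ν := by
  have hN' : (N : ℂ) ≠ 0 := by exact_mod_cast hN.ne'
  have hcard : 1 ≤ ρ.parts.card := Finset.card_pos.2 ⟨o.1, o.2⟩
  simp only [integral_pinnedIntegrand_eq hP hPM hper (blockOf ρ) o _ hN]
  rw [integral_const_mul, integral_finsetSum]
  · rw [expansionCoeffN, Fintype.card_coe]
    congr 1
    -- Only `|ρ| - 1` variables are rescaled: `N^{|ρ|} / N^{n+1} = N^{|ρ|-1} / N^n`.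
    · rw [div_eq_div_iff (pow_ne_zero _ hN') (pow_ne_zero _ hN'), pow_succ (N : ℂ) n,
        ← Nat.sub_add_cancel hcard, pow_succ]
      simp only [Nat.add_sub_cancel]
      ring
    · refine Finset.sum_congr rfl fun i _ => ?_
      rw [integral_prod_exp_mul ν o _ (sum_walkExponent _ i), ← Finset.prod_coe_sort,
        ← Finset.mul_prod_erase _ _ (Finset.mem_univ o)]
      simp only [walkExponent_blockOf, hfour]
  · intro i _
    obtain ⟨C, hC⟩ : ∃ C, ∀ x : ℝ, ‖∏ v ∈ Finset.univ.erase o,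
        (Complex.exp (-(Complex.I * (walkExponent (blockOf ρ) i v : ℂ) * (x : ℂ))) *
          densityFourier P (walkExponent (blockOf ρ) i v))‖ ≤ C := by
      refine ⟨∏ v ∈ Finset.univ.erase o, ‖densityFourier P (walkExponent (blockOf ρ) i v)‖,
        fun x => ?_⟩
      rw [norm_prod]
      refine Finset.prod_le_prod (fun _ _ => norm_nonneg _) fun v _ => ?_
      rw [norm_mul, show -(Complex.I * (walkExponent (blockOf ρ) i v : ℂ) * (x : ℂ)) =
        ((-(walkExponent (blockOf ρ) i v * x) : ℝ) : ℂ) * Complex.I by push_cast; ring,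
        Complex.norm_exp_ofReal_mul_I, one_mul]
    exact Integrable.of_bound (continuous_prod_exp_mul _ _ _).aestronglyMeasurable C
      (Eventually.of_forall hC)

theorem norm_expansionCoeffN_le (hP : Measurable P) (hPM : ∀ y, |P y| ≤ M)
    (hper : Function.Periodic P (2 * Real.pi))
    (hfour : ∀ m, phaseFourier ν m = densityFourier P m) (hn : 0 < n)
    (ρ : Finpartition (Finset.univ : Finset (Fin n))) {N : ℕ} (hN : 0 < N) :
    ‖expansionCoeffN ν ρ N‖ ≤
      n * (M * (2 * Real.pi * (1 + n))) ^ (ρ.parts.card - 1) := by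
  rw [expansionCoeffN_eq_integral hP hPM hper hfour ρ (blockOf ρ ⟨0, hn⟩) hN]
  have h := norm_integral_le_of_norm_le_const (μ := ν) (Eventually.of_forall fun x =>
    norm_integral_pinnedIntegrand_le hPM hn (blockOf ρ) (blockOf_surjective ρ) x hN)
  simpa using h

theorem exists_tendsto_expansionCoeffN (hP : Measurable P) (hPM : ∀ y, |P y| ≤ M)
    (hper : Function.Periodic P (2 * Real.pi))
    (hfour : ∀ m, phaseFourier ν m = densityFourier P m)
    (hcont : ∀ᵐ x ∂ν, ContinuousAt P x) (hn : 0 < n)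
    (ρ : Finpartition (Finset.univ : Finset (Fin n))) :
    ∃ l : ℂ, Tendsto (fun N => expansionCoeffN ν ρ N) atTop (𝓝 l) := by
  set J : ℕ → ℝ → ℂ := fun N x =>
    ∫ z, pinnedIntegrand P (blockOf ρ) (blockOf ρ ⟨0, hn⟩) x N z
      ∂pinnedVolume (blockOf ρ ⟨0, hn⟩) with hJ
  -- Bounded convergence in `x`: the inner bound depends neither on `x` nor on `N`. `limUnder` names
  -- the pointwise limits and is arbitrary only on the `ν`-null set of discontinuities.
  have h : Tendsto (fun N => ∫ x, J N x ∂ν) atTop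
      (𝓝 (∫ x, limUnder atTop (fun N => J N x) ∂ν)) := by
    refine tendsto_integral_filter_of_dominated_convergence
      (fun _ => n * (M * (2 * Real.pi * (1 + n))) ^ (Fintype.card ρ.parts - 1)) ?_ ?_
      (integrable_const _) ?_
    · filter_upwards [eventually_gt_atTop 0] with N hN
      exact (continuous_integral_pinnedIntegrand hP hPM hper _ _ hN).aestronglyMeasurable
    · filter_upwards [eventually_gt_atTop 0] with N hN
      exact Eventually.of_forall fun x =>
        norm_integral_pinnedIntegrand_le hPM hn (blockOf ρ) (blockOf_surjective ρ) x hN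
    · filter_upwards [hcont] with x hx
      exact tendsto_nhds_limUnder
        (exists_tendsto_integral_pinnedIntegrand hP hPM hn _ (blockOf_surjective ρ) hx)
  refine ⟨_, h.congr' ?_⟩
  filter_upwards [eventually_gt_atTop 0] with N hN
  exact (expansionCoeffN_eq_integral hP hPM hper hfour ρ _ hN).symm

/-- The reflection `i ↦ N - 1 - i` permutes the index vectors and negates every exponent at once.
Complex conjugation does the same to the Fourier coefficients, so the prelimit coefficients are
real. -/
theorem blockExponent_rev {n N : ℕ} (i : Fin n → Fin N) (B : Finset (Fin n)) :
    blockExponent (fun k => (i k).rev) B = -blockExponent i B := by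
  rw [blockExponent, blockExponent, ← Finset.sum_neg_distrib]
  refine Finset.sum_congr rfl fun k _ => ?_
  rw [Fin.val_rev, Fin.val_rev]
  have h1 := (i k).isLt
  have h2 := (i ((finRotate n).symm k)).isLt
  omega

theorem sum_prod_neg_blockExponent {n N : ℕ} (s : Finset (Finset (Fin n))) (φ : ℤ → ℂ) :
    ∑ i : Fin n → Fin N, ∏ B ∈ s, φ (-blockExponent i B) =
      ∑ i : Fin n → Fin N, ∏ B ∈ s, φ (blockExponent i B) := by
  rw [← Equiv.sum_comp (Equiv.piCongrRight fun _ : Fin n => (Fin.revPerm : Equiv.Perm (Fin N)))]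
  refine Finset.sum_congr rfl fun i _ => Finset.prod_congr rfl fun B _ => ?_
  have : (Equiv.piCongrRight fun _ : Fin n => (Fin.revPerm : Equiv.Perm (Fin N))) i =
      fun k => (i k).rev := rfl
  rw [this, blockExponent_rev, neg_neg]

theorem conj_phaseFourier (ν : Measure ℝ) (m : ℤ) :
    (starRingEnd ℂ) (phaseFourier ν m) = phaseFourier ν (-m) := by
  rw [phaseFourier, phaseFourier, ← integral_conj]
  congr 1
  ext x
  rw [← Complex.exp_conj]
  congr 1
  simp

theorem conj_expansionCoeffN (ν : Measure ℝ) {n : ℕ}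
    (ρ : Finpartition (Finset.univ : Finset (Fin n))) (N : ℕ) :
    (starRingEnd ℂ) (expansionCoeffN ν ρ N) = expansionCoeffN ν ρ N := by
  rw [expansionCoeffN]
  simp only [map_mul, map_div₀, map_pow, map_natCast, map_sum, map_prod, conj_phaseFourier]
  rw [sum_prod_neg_blockExponent]

/-- `expansionCoeff` is the limit of the real parts only. The complex limit, once known to exist, is
a limit of real numbers and so agrees with it. -/
theorem tendsto_expansionCoeffN (hP : Measurable P) (hPM : ∀ y, |P y| ≤ M)
    (hper : Function.Periodic P (2 * Real.pi))
    (hfour : ∀ m, phaseFourier ν m = densityFourier P m)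
    (hcont : ∀ᵐ x ∂ν, ContinuousAt P x) (hn : 0 < n)
    (ρ : Finpartition (Finset.univ : Finset (Fin n))) :
    Tendsto (fun N => expansionCoeffN ν ρ N) atTop (𝓝 (expansionCoeff ν ρ : ℂ)) := by
  obtain ⟨l, hl⟩ := exists_tendsto_expansionCoeffN hP hPM hper hfour hcont hn ρ
  have hre : Tendsto (fun N => (expansionCoeffN ν ρ N).re) atTop (𝓝 l.re) :=
    (Complex.continuous_re.tendsto l).comp hl
  have hlr : expansionCoeff ν ρ = l.re := hre.limUnder_eq
  have hl' : (l.re : ℂ) = l := by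
    rw [← Complex.conj_eq_iff_re]
    refine tendsto_nhds_unique ((Complex.continuous_conj.tendsto l).comp hl) ?_
    refine hl.congr fun N => ?_
    exact (conj_expansionCoeffN ν ρ N).symm
  rw [hlr, hl']
  exact hl

theorem abs_expansionCoeff_le (hP : Measurable P) (hPM : ∀ y, |P y| ≤ M)
    (hper : Function.Periodic P (2 * Real.pi))
    (hfour : ∀ m, phaseFourier ν m = densityFourier P m)
    (hcont : ∀ᵐ x ∂ν, ContinuousAt P x) (hn : 0 < n)
    (ρ : Finpartition (Finset.univ : Finset (Fin n))) :
    |expansionCoeff ν ρ| ≤ n * (M * (2 * Real.pi * (1 + n))) ^ (ρ.parts.card - 1) := by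
  rw [← Real.norm_eq_abs, ← Complex.norm_real]
  refine le_of_tendsto (tendsto_expansionCoeffN hP hPM hper hfour hcont hn ρ).norm ?_
  filter_upwards [eventually_gt_atTop 0] with N hN
  exact norm_expansionCoeffN_le hP hPM hper hfour hn ρ hN

end RandomVandermonde

namespace RandomVandermonde

/-! ### Expansion of the expected moments over partitions -/

/-- A walk from `i` to `j` with intermediate vertices `a`: `Fin.cons i a` lists the sources of its
steps and `Fin.snoc a j` their targets. -/
theorem pow_succ_apply_eq_sum_prod {ι R : Type*} [Fintype ι] [DecidableEq ι] [CommSemiring R]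
    (A : Matrix ι ι R) (t : ℕ) (i j : ι) :
    (A ^ (t + 1)) i j = ∑ a : Fin t → ι, ∏ k : Fin (t + 1),
      A ((Fin.cons i a : Fin (t + 1) → ι) k) ((Fin.snoc a j : Fin (t + 1) → ι) k) := by
  induction t generalizing i with
  | zero => simp [Fin.snoc]
  | succ t ih =>
    rw [pow_succ', Matrix.mul_apply, ← Equiv.sum_comp (Fin.consEquiv fun _ : Fin (t + 1) => ι),
      Fintype.sum_prod_type]
    refine Finset.sum_congr rfl fun l _ => ?_
    rw [ih l, Finset.mul_sum]
    refine Finset.sum_congr rfl fun a _ => ?_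
    have h : (Fin.consEquiv fun _ : Fin (t + 1) => ι) (l, a) = Fin.cons l a := rfl
    rw [h]
    have h2 : (Fin.snoc (Fin.cons l a : Fin (t + 1) → ι) j : Fin (t + 2) → ι) =
        Fin.cons l (Fin.snoc a j : Fin (t + 1) → ι) :=
      (Fin.cons_snoc_eq_snoc_cons (β := ι) l a j).symm
    rw [h2, Fin.prod_univ_succ (n := t + 1)]
    simp only [Fin.cons_zero, Fin.cons_succ]

theorem trace_pow_eq_sum_prod {ι R : Type*} [Fintype ι] [DecidableEq ι] [CommSemiring R]
    (A : Matrix ι ι R) {n : ℕ} (hn : 0 < n) :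
    (A ^ n).trace = ∑ a : Fin n → ι, ∏ k, A (a k) (a (finRotate n k)) := by
  obtain ⟨t, rfl⟩ : ∃ t, n = t + 1 := ⟨n - 1, by omega⟩
  rw [Matrix.trace, ← Equiv.sum_comp (Fin.consEquiv fun _ : Fin (t + 1) => ι),
    Fintype.sum_prod_type]
  refine Finset.sum_congr rfl fun i _ => ?_
  rw [Matrix.diag_apply, pow_succ_apply_eq_sum_prod]
  refine Finset.sum_congr rfl fun a _ => Finset.prod_congr rfl fun k _ => ?_
  have h : (Fin.consEquiv fun _ : Fin (t + 1) => ι) (i, a) = Fin.cons i a := rfl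
  rw [h]
  congr 1
  refine Fin.lastCases ?_ (fun k => ?_) k
  · simp
  · rw [Fin.snoc_castSucc, finRotate_apply, Fin.coeSucc_eq_succ, Fin.cons_succ]

/-- With `z_a = -N θ_a` the Gram entries become the kernels of `cycleKernel`, so the trace expansion
can reuse the Fourier expansion of the cyclic kernel. -/
theorem gramMatrix_apply {N : ℕ} (hN : 0 < N) {L : ℕ} (θ : Fin L → ℝ) (a b : Fin L) :
    gramMatrix N L θ a b = dirichletMean N (-(N * θ b) - -(N * θ a)) := by
  have hN' : (N : ℝ) ≠ 0 := by exact_mod_cast hN.ne'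
  have hw : (-(N * θ b) - -(N * θ a)) / N = θ a - θ b := by
    field_simp
    ring
  rw [gramMatrix, Matrix.mul_apply, dirichletMean, hw, Finset.mul_sum]
  refine Finset.sum_congr rfl fun k _ => ?_
  have hs : ((Real.sqrt N : ℝ) : ℂ) * (Real.sqrt N : ℝ) = N := by
    rw [← Complex.ofReal_mul, Real.mul_self_sqrt (Nat.cast_nonneg N), Complex.ofReal_natCast]
  simp only [Matrix.conjTranspose_apply, vandermondeMatrix, Matrix.of_apply, RCLike.star_def,
    map_mul, map_div₀, map_one, Complex.conj_ofReal, ← Complex.exp_conj, map_neg, Complex.conj_I,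
    map_natCast]
  rw [mul_mul_mul_comm, ← Complex.exp_add, div_mul_div_comm, one_mul, hs, one_div]
  congr 2
  push_cast
  ring

theorem trace_gramMatrix_pow {N : ℕ} (hN : 0 < N) {L : ℕ} (θ : Fin L → ℝ) {n : ℕ} (hn : 0 < n) :
    (gramMatrix N L θ ^ n).trace =
      ∑ a : Fin n → Fin L, ((N : ℂ)⁻¹) ^ n * ∑ i : Fin n → Fin N, ∏ l,
        Complex.exp (Complex.I * ((-walkExponent a i l : ℤ) : ℂ) * (θ l : ℂ)) := by
  have hN' : (N : ℝ) ≠ 0 := by exact_mod_cast hN.ne'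
  rw [trace_pow_eq_sum_prod _ hn]
  refine Finset.sum_congr rfl fun a _ => ?_
  have h := cycleKernel_eq_sum N a fun l => -(N * θ l)
  rw [cycleKernel] at h
  simp only [gramMatrix_apply hN]
  rw [h]
  congr 1
  refine Finset.sum_congr rfl fun i _ => Finset.prod_congr rfl fun l _ => ?_
  congr 1
  rw [neg_div, mul_div_cancel_left₀ _ hN']
  push_cast
  ring

theorem integrable_exp_mul (ν : Measure ℝ) [IsFiniteMeasure ν] (m : ℤ) :
    Integrable (fun x : ℝ => Complex.exp (Complex.I * (m : ℂ) * (x : ℂ))) ν := by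
  refine Integrable.of_bound (Continuous.aestronglyMeasurable (by fun_prop)) 1
    (Eventually.of_forall fun x => ?_)
  rw [show Complex.I * (m : ℂ) * (x : ℂ) = ((m * x : ℝ) : ℂ) * Complex.I by push_cast; ring,
    Complex.norm_exp_ofReal_mul_I]

theorem integrable_prod_exp_mul (ν : Measure ℝ) [IsProbabilityMeasure ν] {L : ℕ}
    (E : Fin L → ℤ) :
    Integrable (fun θ : Fin L → ℝ => ∏ l, Complex.exp (Complex.I * (E l : ℂ) * (θ l : ℂ)))
      (phaseLaw ν L) :=
  Integrable.fintype_prod_dep fun l => integrable_exp_mul ν (E l)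

theorem integrable_trace_gramMatrix_pow (ν : Measure ℝ) [IsProbabilityMeasure ν] {N : ℕ}
    (hN : 0 < N) (L : ℕ) {n : ℕ} (hn : 0 < n) :
    Integrable (fun θ => (gramMatrix N L θ ^ n).trace) (phaseLaw ν L) := by
  simp only [trace_gramMatrix_pow hN _ hn]
  exact integrable_finsetSum _ fun a _ =>
    (integrable_finsetSum _ fun i _ => integrable_prod_exp_mul ν _).const_mul _

theorem integral_trace_gramMatrix_pow (ν : Measure ℝ) [IsProbabilityMeasure ν] {N : ℕ}
    (hN : 0 < N) (L : ℕ) {n : ℕ} (hn : 0 < n) :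
    ∫ θ, (gramMatrix N L θ ^ n).trace ∂phaseLaw ν L =
      ∑ a : Fin n → Fin L, ((N : ℂ)⁻¹) ^ n * ∑ i : Fin n → Fin N, ∏ l,
        phaseFourier ν (-walkExponent a i l) := by
  simp only [trace_gramMatrix_pow hN _ hn]
  rw [integral_finsetSum _ fun a _ =>
    (integrable_finsetSum _ fun i _ => integrable_prod_exp_mul ν _).const_mul _]
  refine Finset.sum_congr rfl fun a _ => ?_
  rw [integral_const_mul, integral_finsetSum _ fun i _ => integrable_prod_exp_mul ν _]
  congr 1
  refine Finset.sum_congr rfl fun i _ => ?_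
  exact integral_fintype_prod_eq_prod (𝕜 := ℂ)
    (fun l (x : ℝ) => Complex.exp (Complex.I * ((-walkExponent a i l : ℤ) : ℂ) * (x : ℂ)))

/-- Maps out of `Fin n` correspond to partitions of `Fin n` with an injective labelling of the
blocks. -/
theorem bijective_comp_blockOf (n L : ℕ) :
    Function.Bijective fun s : Σ ρ : Finpartition (Finset.univ : Finset (Fin n)),
      (ρ.parts ↪ Fin L) => fun k => s.2 (blockOf s.1 k) := by
  classical
  constructor
  · rintro ⟨ρ, e⟩ ⟨ρ', e'⟩ h
    simp only at h
    have hk : ∀ k j, blockOf ρ k = blockOf ρ j ↔ blockOf ρ' k = blockOf ρ' j := fun k j => by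
      rw [← e.injective.eq_iff, ← e'.injective.eq_iff, congrFun h k, congrFun h j]
    have hpart : ∀ k, ρ.part k = ρ'.part k := by
      intro k
      ext j
      exact (blockOf_eq_iff ρ j (blockOf ρ k)).symm.trans
        ((hk j k).trans (blockOf_eq_iff ρ' j (blockOf ρ' k)))
    have hρ : ρ = ρ' := by
      ext B
      constructor
      · intro hB
        obtain ⟨k, hk⟩ := blockOf_surjective ρ ⟨B, hB⟩
        have := congrArg Subtype.val hk
        simp only [blockOf] at this
        rw [← this, hpart]
        exact (blockOf ρ' k).2
      · intro hB
        obtain ⟨k, hk⟩ := blockOf_surjective ρ' ⟨B, hB⟩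
        have := congrArg Subtype.val hk
        simp only [blockOf] at this
        rw [← this, ← hpart]
        exact (blockOf ρ k).2
    subst hρ
    congr 1
    ext B
    obtain ⟨k, rfl⟩ := blockOf_surjective ρ B
    exact congrArg Fin.val (congrFun h k)
  · intro a
    set ρ := Finpartition.ofSetoid (Setoid.ker a) with hρ
    have hrel : ∀ k j, blockOf ρ k = blockOf ρ j ↔ a k = a j := by
      intro k j
      rw [blockOf_eq_iff]
      have h := Finpartition.mem_part_ofSetoid_iff_rel (s := Setoid.ker a) (a := j) (b := k)
      exact h.trans ⟨fun h => (Setoid.ker_def.1 h).symm, fun h => Setoid.ker_def.2 h.symm⟩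
    have hinv := Function.surjInv_eq (blockOf_surjective ρ)
    refine ⟨⟨ρ, ⟨fun B => a (Function.surjInv (blockOf_surjective ρ) B), ?_⟩⟩, ?_⟩
    · intro B B' hBB
      rw [← hinv B, ← hinv B']
      exact (hrel _ _).2 hBB
    · ext k
      exact congrArg Fin.val ((hrel _ _).1 (hinv (blockOf ρ k)))

/-- Labels outside the range of `e` are never visited; their exponent is an empty sum and their
factor is `φ 0 = 1`. -/
theorem prod_walkExponent_comp_blockOf {n N L : ℕ}
    (ρ : Finpartition (Finset.univ : Finset (Fin n))) (e : ρ.parts ↪ Fin L) (i : Fin n → Fin N)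
    (φ : ℤ → ℂ) (hφ : φ 0 = 1) :
    ∏ l, φ (-walkExponent (fun k => e (blockOf ρ k)) i l) =
      ∏ B ∈ ρ.parts, φ (-blockExponent i B) := by
  rw [← Finset.prod_coe_sort ρ.parts, ← Finset.prod_subset (Finset.subset_univ (Finset.univ.map e))]
  · rw [Finset.prod_map]
    refine Finset.prod_congr rfl fun B _ => ?_
    rw [← walkExponent_blockOf, walkExponent, walkExponent]
    simp only [e.injective.eq_iff]
  · intro l _ hl
    rw [walkExponent, Finset.filter_false_of_mem, blockExponent, Finset.sum_empty, neg_zero, hφ]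
    intro k _ hk
    exact hl (Finset.mem_map.2 ⟨blockOf ρ k, Finset.mem_univ _, hk⟩)

/-- The phases are i.i.d., so the expectation attached to a map `Fin n → Fin L` depends only on its
partition into fibres. Each partition arises from `L (L-1) ⋯ (L-|ρ|+1)` injective labellings. -/
theorem expectedMoment_eq_sum (ν : Measure ℝ) [IsProbabilityMeasure ν] {N L n : ℕ} (hN : 0 < N)
    (hn : 0 < n) :
    expectedMoment ν N L n = ∑ ρ : Finpartition (Finset.univ : Finset (Fin n)),
      ((L.descFactorial ρ.parts.card : ℝ) / (L * (N : ℝ) ^ (ρ.parts.card - 1)) : ℝ) *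
        expansionCoeffN ν ρ N := by
  have hN' : (N : ℂ) ≠ 0 := by exact_mod_cast hN.ne'
  have hφ : phaseFourier ν 0 = 1 := by simp [phaseFourier]
  rw [expectedMoment, integral_const_mul, integral_trace_gramMatrix_pow ν hN L hn,
    ← (bijective_comp_blockOf n L).sum_comp, Fintype.sum_sigma, Finset.mul_sum]
  refine Finset.sum_congr rfl fun ρ _ => ?_
  simp only [prod_walkExponent_comp_blockOf _ _ _ _ hφ, sum_prod_neg_blockExponent]
  rw [Finset.sum_const, Finset.card_univ, Fintype.card_embedding_eq, Fintype.card_fin,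
    Fintype.card_coe, expansionCoeffN, nsmul_eq_mul]
  have hcard : 1 ≤ ρ.parts.card :=
    Finset.card_pos.2 ⟨(blockOf ρ ⟨0, hn⟩).1, (blockOf ρ ⟨0, hn⟩).2⟩
  obtain ⟨r, hr⟩ : ∃ r, ρ.parts.card = r + 1 := ⟨ρ.parts.card - 1, by omega⟩
  rw [hr]
  push_cast
  rcases Nat.eq_zero_or_pos L with rfl | hL
  · simp
  have hL' : (L : ℂ) ≠ 0 := by exact_mod_cast hL.ne'
  rw [inv_pow]
  field_simp
  ring

/-- The denominator `L` cancels the first factor, and each of the remaining `r - 1` quotients tends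
to `c`. When `c = 0`, `L` may stay bounded, even below `r`; the squeeze for the truncated
subtraction does not need `L → ∞`. -/
theorem tendsto_descFactorial_div {N L : ℕ → ℕ} {c : ℝ} (hL : ∀ j, 0 < L j)
    (hN : Tendsto N atTop atTop)
    (hc : Tendsto (fun j => (L j : ℝ) / (N j : ℝ)) atTop (𝓝 c)) {r : ℕ} (hr : 1 ≤ r) :
    Tendsto (fun j => ((L j).descFactorial r : ℝ) / (L j * (N j : ℝ) ^ (r - 1))) atTop
      (𝓝 (c ^ (r - 1))) := by
  obtain ⟨s, rfl⟩ : ∃ s, r = s + 1 := ⟨r - 1, by omega⟩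
  simp only [Nat.add_sub_cancel]
  have hNR : Tendsto (fun j => (N j : ℝ)) atTop atTop := tendsto_natCast_atTop_atTop.comp hN
  have hfac : ∀ t : ℕ, Tendsto (fun j => ((L j - (t + 1) : ℕ) : ℝ) / (N j : ℝ)) atTop (𝓝 c) := by
    intro t
    have hlow : Tendsto (fun j => (L j : ℝ) / (N j : ℝ) - ((t : ℝ) + 1) / (N j : ℝ)) atTop
        (𝓝 c) := by
      simpa using hc.sub (tendsto_const_nhds.div_atTop hNR)
    refine tendsto_of_tendsto_of_tendsto_of_le_of_le hlow hc (fun j => ?_) fun j => ?_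
    · simp only
      rw [← sub_div]
      gcongr
      have h2 : L j ≤ (L j - (t + 1)) + (t + 1) := by omega
      have h3 : (L j : ℝ) ≤ ((L j - (t + 1) : ℕ) : ℝ) + (t + 1) := by exact_mod_cast h2
      linarith
    · simp only
      gcongr
      omega
  have hprod : Tendsto (fun j => ∏ t ∈ Finset.range s, ((L j - (t + 1) : ℕ) : ℝ) / (N j : ℝ)) atTop
      (𝓝 (c ^ s)) := by
    have := tendsto_finsetProd (Finset.range s) fun t _ => hfac t
    simpa using this
  refine hprod.congr fun j => ?_
  have hL' : (L j : ℝ) ≠ 0 := by exact_mod_cast (hL j).ne'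
  rw [Nat.descFactorial_eq_prod_range, Finset.prod_range_succ', Finset.prod_div_distrib,
    Finset.prod_const, Finset.card_range]
  push_cast
  rw [Nat.sub_zero, mul_comm (∏ _ ∈ _, _), mul_div_mul_left _ _ hL']

theorem tendsto_expectedMoment (ν : Measure ℝ) [IsProbabilityMeasure ν] {n : ℕ} (hn : 0 < n)
    (hK : ∀ ρ : Finpartition (Finset.univ : Finset (Fin n)),
      Tendsto (fun N : ℕ => expansionCoeffN ν ρ N) atTop (𝓝 (expansionCoeff ν ρ : ℂ)))
    {N L : ℕ → ℕ} {c : ℝ} (hL : ∀ j, 0 < L j) (hN : Tendsto N atTop atTop)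
    (hc : Tendsto (fun j => (L j : ℝ) / (N j : ℝ)) atTop (𝓝 c)) :
    Tendsto (fun j => expectedMoment ν (N j) (L j) n) atTop (𝓝 (limitMoment ν c n : ℂ)) := by
  have h : Tendsto (fun j => ∑ ρ : Finpartition (Finset.univ : Finset (Fin n)),
      ((((L j).descFactorial ρ.parts.card : ℝ) / (L j * (N j : ℝ) ^ (ρ.parts.card - 1)) : ℝ) : ℂ) *
        expansionCoeffN ν ρ (N j)) atTop (𝓝 (limitMoment ν c n : ℂ)) := by
    rw [limitMoment]
    push_cast
    refine tendsto_finsetSum _ fun ρ _ => ?_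
    have hcard : 1 ≤ ρ.parts.card :=
      Finset.card_pos.2 ⟨(blockOf ρ ⟨0, hn⟩).1, (blockOf ρ ⟨0, hn⟩).2⟩
    have h1 := (Complex.continuous_ofReal.tendsto _).comp (tendsto_descFactorial_div hL hN hc hcard)
    have h2 := h1.mul ((hK ρ).comp hN)
    rw [mul_comm] at h2
    push_cast at h2
    refine h2.congr fun j => ?_
    simp
  refine h.congr' ?_
  filter_upwards [hN.eventually_gt_atTop 0] with j hj
  exact (expectedMoment_eq_sum ν hj hn).symm

end RandomVandermonde

namespace RandomVandermonde

/-! ### Moments of the averaged eigenvalue distribution -/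

open scoped ComplexOrder in
theorem eigenvalues_gramMatrix_nonneg (N L : ℕ) (θ : Fin L → ℝ) (i : Fin L) :
    0 ≤ (gramMatrix_isHermitian N L θ).eigenvalues i :=
  (Matrix.posSemidef_conjTranspose_mul_self (vandermondeMatrix N L θ)).eigenvalues_nonneg i

theorem lintegral_averagedMeasure (ν : Measure ℝ) (N : ℕ) {L : ℕ} (hL : 0 < L) {f : ℝ → ℝ≥0∞}
    (hf : Measurable f) :
    ∫⁻ t, f t ∂averagedMeasure ν N L = ∫⁻ θ, (L : ℝ≥0∞)⁻¹ *
      ∑ i, f ((gramMatrix_isHermitian N L θ).eigenvalues i) ∂phaseLaw ν L := by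
  rw [averagedMeasure, Measure.lintegral_bind (measurable_empiricalMeasure N hL).aemeasurable
    hf.aemeasurable]
  refine lintegral_congr fun θ => ?_
  rw [empiricalMeasure, lintegral_smul_measure, lintegral_finsetSum_measure, smul_eq_mul]
  simp only [lintegral_dirac' _ hf]

theorem averagedMeasure_Iio_zero (ν : Measure ℝ) (N : ℕ) {L : ℕ} (hL : 0 < L) :
    averagedMeasure ν N L (Set.Iio 0) = 0 := by
  rw [← lintegral_indicator_one measurableSet_Iio,
    lintegral_averagedMeasure ν N hL (measurable_one.indicator measurableSet_Iio)]
  simp [Set.indicator, (eigenvalues_gramMatrix_nonneg N L _ _).not_gt]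

theorem ae_averagedMeasure_nonneg (ν : Measure ℝ) (N : ℕ) {L : ℕ} (hL : 0 < L) :
    ∀ᵐ t ∂averagedMeasure ν N L, 0 ≤ t := by
  rw [ae_iff]
  simpa [Set.Iio] using averagedMeasure_Iio_zero ν N hL

/-- The identity is proved for lower integrals, so that integrability of `t ^ n` under the mixture
comes out of it instead of being needed beforehand. -/
theorem lintegral_pow_averagedMeasure (ν : Measure ℝ) [IsProbabilityMeasure ν] {N L n : ℕ}
    (hN : 0 < N) (hL : 0 < L) (hn : 0 < n) :
    ∫⁻ t, ENNReal.ofReal (t ^ n) ∂averagedMeasure ν N L =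
        ENNReal.ofReal (expectedMoment ν N L n).re ∧ 0 ≤ (expectedMoment ν N L n).re := by
  have hL' : (0 : ℝ) < L := by exact_mod_cast hL
  set F : (Fin L → ℝ) → ℝ := fun θ => (L : ℝ)⁻¹ *
    ∑ i, (gramMatrix_isHermitian N L θ).eigenvalues i ^ n with hF
  have hF0 : ∀ θ, 0 ≤ F θ := fun θ => mul_nonneg (by positivity)
    (Finset.sum_nonneg fun i _ => pow_nonneg (eigenvalues_gramMatrix_nonneg N L θ i) n)
  have hre : ∀ θ, F θ = (1 / (L : ℂ) * (gramMatrix N L θ ^ n).trace).re := fun θ => by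
    rw [hF]
    simp only
    rw [← trace_pow_eq_sum, one_div, show ((L : ℂ)⁻¹) = (((L : ℝ)⁻¹ : ℝ) : ℂ) by push_cast; rfl,
      Complex.re_ofReal_mul]
  have hint : Integrable (fun θ => 1 / (L : ℂ) * (gramMatrix N L θ ^ n).trace) (phaseLaw ν L) :=
    (integrable_trace_gramMatrix_pow ν hN L hn).const_mul _
  have hFint : Integrable F (phaseLaw ν L) := by
    refine hint.re.congr (Eventually.of_forall fun θ => ?_)
    exact (hre θ).symm
  have hEF : (expectedMoment ν N L n).re = ∫ θ, F θ ∂phaseLaw ν L := by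
    rw [expectedMoment]
    simp only [hre]
    exact (integral_re hint).symm
  refine ⟨?_, ?_⟩
  · rw [lintegral_averagedMeasure ν N hL (f := fun t => ENNReal.ofReal (t ^ n))
        (ENNReal.measurable_ofReal.comp (measurable_id.pow_const n)), hEF, ofReal_integral_eq_lintegral_ofReal hFint (Eventually.of_forall hF0)]
    refine lintegral_congr fun θ => ?_
    rw [hF]
    simp only
    rw [ENNReal.ofReal_mul (by positivity), ENNReal.ofReal_inv_of_pos hL', ENNReal.ofReal_natCast,
      ENNReal.ofReal_sum_of_nonneg fun i _ =>
        pow_nonneg (eigenvalues_gramMatrix_nonneg N L θ i) n]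
  · rw [hEF]
    exact integral_nonneg hF0

theorem integrable_pow_averagedMeasure (ν : Measure ℝ) [IsProbabilityMeasure ν] {N L n : ℕ}
    (hN : 0 < N) (hL : 0 < L) (hn : 0 < n) :
    Integrable (fun t : ℝ => t ^ n) (averagedMeasure ν N L) := by
  refine ⟨(measurable_id.pow_const n).aestronglyMeasurable, ?_⟩
  rw [hasFiniteIntegral_iff_ofReal]
  · rw [(lintegral_pow_averagedMeasure ν hN hL hn).1]
    exact ENNReal.ofReal_lt_top
  · filter_upwards [ae_averagedMeasure_nonneg ν N hL] with t ht using pow_nonneg ht n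

theorem integral_pow_averagedMeasure (ν : Measure ℝ) [IsProbabilityMeasure ν] {N L n : ℕ}
    (hN : 0 < N) (hL : 0 < L) (hn : 0 < n) :
    ∫ t, t ^ n ∂averagedMeasure ν N L = (expectedMoment ν N L n).re := by
  have h := lintegral_pow_averagedMeasure ν hN hL hn
  rw [integral_eq_lintegral_of_nonneg_ae _ (continuous_pow n).aestronglyMeasurable, h.1,
    ENNReal.toReal_ofReal h.2]
  filter_upwards [ae_averagedMeasure_nonneg ν N hL] with t ht using pow_nonneg ht n

/-! ### Weak limits and moments -/

theorem ae_nonneg_iff_measure_Iio {μ : Measure ℝ} : (∀ᵐ t ∂μ, 0 ≤ t) ↔ μ (Set.Iio 0) = 0 := by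
  rw [ae_iff]
  simp [Set.Iio]

/-- The bounded continuous test function `min 1 t⁻` is positive exactly on the negative axis, so its
vanishing integral passes to the limit. -/
theorem measure_Iio_zero_of_tendsto {ι : Type*} {l : Filter ι} [l.NeBot]
    {μs : ι → ProbabilityMeasure ℝ} {μ : ProbabilityMeasure ℝ} (h : Tendsto μs l (𝓝 μ))
    (hpos : ∀ᶠ j in l, (μs j : Measure ℝ) (Set.Iio 0) = 0) : (μ : Measure ℝ) (Set.Iio 0) = 0 := by
  let f : BoundedContinuousFunction ℝ ℝ :=
    BoundedContinuousFunction.ofNormedAddCommGroup (fun t => min 1 (max 0 (-t))) (by fun_prop) 1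
      fun t => by
        rw [Real.norm_eq_abs, abs_of_nonneg (le_min zero_le_one (le_max_left _ _))]
        exact min_le_left _ _
  have hf : ∀ t, f t = min 1 (max 0 (-t)) := fun _ => rfl
  have h1 := (ProbabilityMeasure.tendsto_iff_forall_integral_tendsto.1 h) f
  have h2 : ∫ t, f t ∂(μ : Measure ℝ) = 0 := by
    refine tendsto_nhds_unique h1 (tendsto_const_nhds.congr' ?_)
    filter_upwards [hpos] with j hj
    refine (integral_eq_zero_of_ae ?_).symm
    filter_upwards [ae_nonneg_iff_measure_Iio.2 hj] with t ht
    rw [hf, max_eq_left (by linarith), min_eq_right zero_le_one]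
    rfl
  rw [integral_eq_zero_iff_of_nonneg (fun t => by
    rw [hf]; exact le_min zero_le_one (le_max_left _ _)) (f.integrable _)] at h2
  refine ae_nonneg_iff_measure_Iio.1 ?_
  filter_upwards [h2] with t ht
  by_contra hneg
  rw [hf, Pi.zero_apply] at ht
  have : 0 < min 1 (max 0 (-t)) := lt_min zero_lt_one (lt_max_of_lt_right (by linarith))
  linarith

/-- The bounded continuous function `t ↦ (min t⁺ A) ^ n`. -/
noncomputable def truncatedPow (A : ℝ≥0) (n : ℕ) : BoundedContinuousFunction ℝ ℝ :=
  BoundedContinuousFunction.ofNormedAddCommGroup (fun t => (min (max t 0) A) ^ n) (by fun_prop)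
    ((A : ℝ) ^ n) fun t => by
      have h0 : 0 ≤ min (max t 0) (A : ℝ) := le_min (le_max_right _ _) A.2
      rw [Real.norm_eq_abs, abs_of_nonneg (pow_nonneg h0 n)]
      exact pow_le_pow_left₀ h0 (min_le_right _ _) n

theorem truncatedPow_apply (A : ℝ≥0) (n : ℕ) (t : ℝ) :
    truncatedPow A n t = (min (max t 0) A) ^ n := rfl

theorem truncatedPow_nonneg (A : ℝ≥0) (n : ℕ) (t : ℝ) : 0 ≤ truncatedPow A n t :=
  pow_nonneg (le_min (le_max_right _ _) A.2) n

theorem truncatedPow_le {A : ℝ≥0} {n : ℕ} {t : ℝ} (ht : 0 ≤ t) : truncatedPow A n t ≤ t ^ n := by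
  rw [truncatedPow_apply, max_eq_left ht]
  exact pow_le_pow_left₀ (le_min ht A.2) (min_le_left _ _) n

/-- Where the truncation is active, `t ≥ A`, so the next moment divided by `A` pays for the error.
-/
theorem pow_le_truncatedPow_add {A : ℝ≥0} (hA : 0 < A) {n : ℕ} {t : ℝ} (ht : 0 ≤ t) :
    t ^ n ≤ truncatedPow A n t + (A : ℝ)⁻¹ * t ^ (n + 1) := by
  have hA' : (0 : ℝ) < A := hA
  rcases le_total t A with h | h
  · rw [truncatedPow_apply, max_eq_left ht, min_eq_left h]
    have : 0 ≤ (A : ℝ)⁻¹ * t ^ (n + 1) := by positivity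
    linarith
  · have h1 : t ^ n ≤ (A : ℝ)⁻¹ * t ^ (n + 1) := by
      rw [pow_succ, ← mul_assoc, mul_comm (A : ℝ)⁻¹, mul_assoc]
      refine le_mul_of_one_le_right (by positivity) ?_
      rw [inv_mul_eq_div, one_le_div hA']
      exact h
    linarith [truncatedPow_nonneg A n t]

/-- Weak convergence sees only the truncated powers. Fatou's lemma gives one inequality as the
cut-off grows; for the other, truncating at `k` costs at most `m (n + 1) / k` in the limit. The
filter is arbitrary so that ultrafilters are allowed. -/
theorem moments_of_tendsto {ι : Type*} {l : Filter ι} [l.NeBot]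
    {μs : ι → ProbabilityMeasure ℝ} {μ : ProbabilityMeasure ℝ} (h : Tendsto μs l (𝓝 μ))
    (hpos : ∀ᶠ j in l, (μs j : Measure ℝ) (Set.Iio 0) = 0) {m : ℕ → ℝ}
    (hint : ∀ n, 1 ≤ n → ∀ᶠ j in l, Integrable (fun t : ℝ => t ^ n) (μs j : Measure ℝ))
    (hm : ∀ n, 1 ≤ n → Tendsto (fun j => ∫ t, t ^ n ∂(μs j : Measure ℝ)) l (𝓝 (m n)))
    (n : ℕ) (hn : 1 ≤ n) :
    Integrable (fun t : ℝ => t ^ n) (μ : Measure ℝ) ∧ ∫ t, t ^ n ∂(μ : Measure ℝ) = m n := by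
  have hμ : ∀ᵐ t ∂(μ : Measure ℝ), 0 ≤ t :=
    ae_nonneg_iff_measure_Iio.2 (measure_Iio_zero_of_tendsto h hpos)
  have htrunc : ∀ A, Tendsto (fun j => ∫ t, truncatedPow A n t ∂(μs j : Measure ℝ)) l
      (𝓝 (∫ t, truncatedPow A n t ∂(μ : Measure ℝ))) := fun A =>
    (ProbabilityMeasure.tendsto_iff_forall_integral_tendsto.1 h) _
  have hupper : ∀ A, ∫ t, truncatedPow A n t ∂(μ : Measure ℝ) ≤ m n := by
    intro A
    refine le_of_tendsto_of_tendsto (htrunc A) (hm n hn) ?_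
    filter_upwards [hpos, hint n hn] with j hj hij
    refine integral_mono_ae ((truncatedPow A n).integrable _) hij ?_
    filter_upwards [ae_nonneg_iff_measure_Iio.2 hj] with t ht using truncatedPow_le ht
  have hlint : ∫⁻ t, ENNReal.ofReal (t ^ n) ∂(μ : Measure ℝ) ≤ ENNReal.ofReal (m n) := by
    have hconv : ∀ᵐ t ∂(μ : Measure ℝ), ENNReal.ofReal (t ^ n) =
        liminf (fun k : ℕ => ENNReal.ofReal (truncatedPow k n t)) atTop := by
      filter_upwards [hμ] with t ht
      refine (Tendsto.liminf_eq ?_).symm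
      refine tendsto_const_nhds.congr' ?_
      filter_upwards [(tendsto_natCast_atTop_atTop (R := ℝ)).eventually_ge_atTop t] with k hk
      rw [truncatedPow_apply, max_eq_left ht, NNReal.coe_natCast, min_eq_left hk]
    rw [lintegral_congr_ae hconv]
    refine (lintegral_liminf_le (u := (atTop : Filter ℕ))
      (f := fun (k : ℕ) t => ENNReal.ofReal (truncatedPow k n t)) fun k => ENNReal.measurable_ofReal.comp
      (truncatedPow k n).continuous.measurable).trans ?_
    refine (liminf_le_liminf (Eventually.of_forall fun k => ?_)).trans
      (liminf_const (ENNReal.ofReal (m n))).le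
    rw [← ofReal_integral_eq_lintegral_ofReal ((truncatedPow k n).integrable _)
      (Eventually.of_forall fun t => truncatedPow_nonneg _ _ t)]
    exact ENNReal.ofReal_le_ofReal (hupper k)
  have hI : Integrable (fun t : ℝ => t ^ n) (μ : Measure ℝ) := by
    refine ⟨(measurable_id.pow_const n).aestronglyMeasurable, ?_⟩
    rw [hasFiniteIntegral_iff_ofReal]
    · exact hlint.trans_lt ENNReal.ofReal_lt_top
    · filter_upwards [hμ] with t ht using pow_nonneg ht n
  refine ⟨hI, le_antisymm ?_ ?_⟩
  · have hm0 : 0 ≤ m n := by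
      refine ge_of_tendsto (hm n hn) ?_
      filter_upwards [hpos] with j hj
      refine integral_nonneg_of_ae ?_
      filter_upwards [ae_nonneg_iff_measure_Iio.2 hj] with t ht using pow_nonneg ht n
    rw [← ENNReal.ofReal_le_ofReal_iff hm0, ofReal_integral_eq_lintegral_ofReal hI]
    · exact hlint
    · filter_upwards [hμ] with t ht using pow_nonneg ht n
  · have hlower : ∀ k : ℕ, 0 < k →
        m n ≤ ∫ t, t ^ n ∂(μ : Measure ℝ) + (k : ℝ)⁻¹ * m (n + 1) := by
      intro k hk
      have hk' : (0 : ℝ≥0) < k := by exact_mod_cast hk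
      have h1 : m n ≤ ∫ t, truncatedPow k n t ∂(μ : Measure ℝ) + (k : ℝ)⁻¹ * m (n + 1) := by
        refine le_of_tendsto_of_tendsto (hm n hn)
          ((htrunc k).add ((hm (n + 1) (by omega)).const_mul _)) ?_
        filter_upwards [hpos, hint n hn, hint (n + 1) (by omega)] with j hj hij hij'
        rw [← integral_const_mul, ← integral_add ((truncatedPow k n).integrable _)
          (hij'.const_mul _)]
        refine integral_mono_ae hij (((truncatedPow k n).integrable _).add (hij'.const_mul _)) ?_
        filter_upwards [ae_nonneg_iff_measure_Iio.2 hj] with t ht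
        have := pow_le_truncatedPow_add hk' (n := n) ht
        simpa using this
      have h2 : ∫ t, truncatedPow k n t ∂(μ : Measure ℝ) ≤ ∫ t, t ^ n ∂(μ : Measure ℝ) := by
        refine integral_mono_ae ((truncatedPow k n).integrable _) hI ?_
        filter_upwards [hμ] with t ht using truncatedPow_le ht
      linarith
    have hlim : Tendsto (fun k : ℕ => ∫ t, t ^ n ∂(μ : Measure ℝ) + (k : ℝ)⁻¹ * m (n + 1)) atTop
        (𝓝 (∫ t, t ^ n ∂(μ : Measure ℝ))) := by
      simpa using (tendsto_const_nhds (x := ∫ t, t ^ n ∂(μ : Measure ℝ))).add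
        ((tendsto_inv_atTop_nhds_zero_nat (𝕜 := ℝ)).mul_const (m (n + 1)))
    refine ge_of_tendsto hlim ?_
    filter_upwards [eventually_gt_atTop 0] with k hk using hlower k hk

/-- Probability measures on `[0, ∞)` with bounded mean lie in a compact set. -/
theorem exists_isCompact_of_mean_le (C : ℝ) :
    ∃ s : Set (ProbabilityMeasure ℝ), IsCompact s ∧ ∀ μ : ProbabilityMeasure ℝ,
      (μ : Measure ℝ) (Set.Iio 0) = 0 → Integrable (fun t : ℝ => t) (μ : Measure ℝ) →
      ∫ t, t ∂(μ : Measure ℝ) ≤ C → μ ∈ s := by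
  have hu : Tendsto (fun k : ℕ => Real.toNNReal (C / (k + 1))) atTop (𝓝 0) := by
    have h : Tendsto (fun k : ℕ => C / ((k : ℝ) + 1)) atTop (𝓝 0) :=
      tendsto_const_nhds.div_atTop (tendsto_atTop_add_const_right _ _ tendsto_natCast_atTop_atTop)
    simpa [Function.comp_def] using (continuous_real_toNNReal.tendsto 0).comp h
  refine ⟨_, isCompact_setOfPred_probabilityMeasure_mass_eq_compl_isCompact_le hu
    (K := fun k : ℕ => Set.Icc 0 ((k : ℝ) + 1)) (fun _ => isCompact_Icc) (Or.inl inferInstance), ?_⟩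
  intro μ hμ hint hC k
  have h0 := ae_nonneg_iff_measure_Iio.2 hμ
  have hk : (0 : ℝ) < (k : ℝ) + 1 := by positivity
  -- Markov's inequality: the mass outside `[0, k + 1]` is at most `C / (k + 1)`, which is the
  -- uniform tightness behind the compact set.
  have hM := mul_meas_ge_le_integral_of_nonneg h0 hint ((k : ℝ) + 1)
  have hle : (μ : Measure ℝ) (Set.Icc 0 ((k : ℝ) + 1))ᶜ ≤
      (μ : Measure ℝ) {t | (k : ℝ) + 1 ≤ t} := by
    refine measure_mono_ae ?_
    filter_upwards [h0] with t ht htm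
    by_contra hcon
    exact htm ⟨ht, (not_le.1 hcon).le⟩
  have hreal : (μ : Measure ℝ).real (Set.Icc 0 ((k : ℝ) + 1))ᶜ ≤ C / (k + 1) := by
    rw [le_div_iff₀ hk, mul_comm]
    refine le_trans ?_ (hM.trans hC)
    exact mul_le_mul_of_nonneg_left (ENNReal.toReal_mono (measure_ne_top _ _) hle) hk.le
  rw [← NNReal.coe_le_coe]
  exact hreal.trans (Real.le_coe_toNNReal _)

end RandomVandermonde

namespace RandomVandermonde

/-! ### Determinacy of the moment problem -/

/-- Exponential moments make both complex moment generating functions analytic on a vertical strip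
around the imaginary axis. The moments are their derivatives at `0`, so the identity theorem makes
them agree on the strip, in particular on the imaginary axis, where they are the characteristic
functions. -/
theorem ext_of_moments {μ₁ μ₂ : Measure ℝ} [IsProbabilityMeasure μ₁] [IsProbabilityMeasure μ₂]
    (h₁ : 0 ∈ interior (ProbabilityTheory.integrableExpSet id μ₁))
    (h₂ : 0 ∈ interior (ProbabilityTheory.integrableExpSet id μ₂))
    (hm : ∀ n : ℕ, ∫ x, x ^ n ∂μ₁ = ∫ x, x ^ n ∂μ₂) : μ₁ = μ₂ := by
  set S : Set ℝ := interior (ProbabilityTheory.integrableExpSet id μ₁) ∩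
    interior (ProbabilityTheory.integrableExpSet id μ₂) with hS
  set U : Set ℂ := {z | z.re ∈ S} with hU
  have hconv : Convex ℝ S := (ProbabilityTheory.convex_integrableExpSet.interior).inter
    (ProbabilityTheory.convex_integrableExpSet.interior)
  have hUpre : IsPreconnected U :=
    (hconv.linear_preimage Complex.reLm).isPreconnected
  have h0U : (0 : ℂ) ∈ U := ⟨by simpa using h₁, by simpa using h₂⟩
  have ha₁ : AnalyticOnNhd ℂ (ProbabilityTheory.complexMGF id μ₁) U :=
    fun z hz => ProbabilityTheory.analyticAt_complexMGF hz.1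
  have ha₂ : AnalyticOnNhd ℂ (ProbabilityTheory.complexMGF id μ₂) U :=
    fun z hz => ProbabilityTheory.analyticAt_complexMGF hz.2
  have hder : ∀ n, iteratedDeriv n (ProbabilityTheory.complexMGF id μ₁) 0 =
      iteratedDeriv n (ProbabilityTheory.complexMGF id μ₂) 0 := by
    intro n
    rw [ProbabilityTheory.iteratedDeriv_complexMGF (by simpa using h₁),
      ProbabilityTheory.iteratedDeriv_complexMGF (by simpa using h₂)]
    have h := congrArg (fun r : ℝ => (r : ℂ)) (hm n)
    simpa [← integral_complex_ofReal] using h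
  have hev : ProbabilityTheory.complexMGF id μ₁ =ᶠ[𝓝 0] ProbabilityTheory.complexMGF id μ₂ := by
    have p₁ := (ha₁ 0 h0U).hasFPowerSeriesAt
    have p₂ := (ha₂ 0 h0U).hasFPowerSeriesAt
    simp only [hder] at p₁
    have h := p₁.sub p₂
    rw [sub_self] at h
    filter_upwards [h.eventually_eq_zero] with z hz
    exact sub_eq_zero.1 hz
  have heq := ha₁.eqOn_of_preconnected_of_eventuallyEq ha₂ hUpre h0U hev
  refine Measure.ext_of_charFun ?_
  ext t
  rw [← ProbabilityTheory.complexMGF_id_mul_I, ← ProbabilityTheory.complexMGF_id_mul_I]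
  refine heq ?_
  have : ((t : ℂ) * Complex.I).re = 0 := by simp
  exact ⟨by rw [this]; exact h₁, by rw [this]; exact h₂⟩

/-- The symmetric distribution whose square has law `μ`. -/
noncomputable def symmetrizedSqrt (μ : Measure ℝ) : Measure ℝ :=
  (2⁻¹ : ℝ≥0∞) • (μ.map Real.sqrt + μ.map fun x => -Real.sqrt x)

theorem measurable_neg_sqrt : Measurable fun x : ℝ => -Real.sqrt x :=
  Real.continuous_sqrt.neg.measurable

instance (μ : Measure ℝ) [IsProbabilityMeasure μ] : IsProbabilityMeasure (symmetrizedSqrt μ) := by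
  constructor
  rw [symmetrizedSqrt, Measure.smul_apply, Measure.add_apply,
    Measure.map_apply Real.continuous_sqrt.measurable MeasurableSet.univ,
    Measure.map_apply measurable_neg_sqrt MeasurableSet.univ]
  simp only [Set.preimage_univ, measure_univ, smul_eq_mul]
  rw [one_add_one_eq_two, ENNReal.inv_mul_cancel two_ne_zero ENNReal.ofNat_ne_top]

theorem map_sq_symmetrizedSqrt {μ : Measure ℝ} (hμ : μ (Set.Iio 0) = 0) :
    (symmetrizedSqrt μ).map (fun y => y ^ 2) = μ := by
  have hsq : Measurable fun y : ℝ => y ^ 2 := measurable_id.pow_const 2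
  have h0 := ae_nonneg_iff_measure_Iio.2 hμ
  have h1 : μ.map ((fun y : ℝ => y ^ 2) ∘ Real.sqrt) = μ := by
    conv_rhs => rw [← Measure.map_id (μ := μ)]
    refine Measure.map_congr ?_
    filter_upwards [h0] with x hx using Real.sq_sqrt hx
  have h2 : μ.map ((fun y : ℝ => y ^ 2) ∘ fun x => -Real.sqrt x) = μ := by
    conv_rhs => rw [← Measure.map_id (μ := μ)]
    refine Measure.map_congr ?_
    filter_upwards [h0] with x hx
    simp only [Function.comp_apply, neg_sq, Real.sq_sqrt hx, id]
  rw [symmetrizedSqrt, Measure.map_smul, Measure.map_add _ _ hsq,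
    Measure.map_map hsq Real.continuous_sqrt.measurable, Measure.map_map hsq measurable_neg_sqrt,
    h1, h2, ← two_smul ℝ≥0∞ μ, smul_smul, ENNReal.inv_mul_cancel two_ne_zero ENNReal.ofNat_ne_top,
    one_smul]

theorem integrable_sqrt_pow {μ : Measure ℝ} [IsProbabilityMeasure μ] (hμ : μ (Set.Iio 0) = 0)
    (hint : ∀ n : ℕ, 1 ≤ n → Integrable (fun t : ℝ => t ^ n) μ) (n : ℕ) :
    Integrable (fun t => Real.sqrt t ^ n) μ := by
  have h0 := ae_nonneg_iff_measure_Iio.2 hμ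
  rcases Nat.eq_zero_or_pos n with rfl | hn
  · simp
  refine ((integrable_const (1 : ℝ)).add (hint n hn)).mono'
    (Real.continuous_sqrt.pow n).aestronglyMeasurable ?_
  filter_upwards [h0] with t ht
  rw [Real.norm_eq_abs, abs_of_nonneg (by positivity), Pi.add_apply]
  rcases le_total t 1 with h | h
  · have h1 : Real.sqrt t ≤ 1 := Real.sqrt_le_one.2 h
    have h2 := pow_le_one₀ (n := n) (Real.sqrt_nonneg t) h1
    have h3 := pow_nonneg ht n
    linarith
  · have h1 : Real.sqrt t ≤ t := by
      rw [Real.sqrt_le_left ht]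
      nlinarith
    have h2 := pow_le_pow_left₀ (Real.sqrt_nonneg t) h1 n
    linarith

theorem integral_pow_symmetrizedSqrt {μ : Measure ℝ} [IsProbabilityMeasure μ]
    (hμ : μ (Set.Iio 0) = 0) (hint : ∀ n : ℕ, 1 ≤ n → Integrable (fun t : ℝ => t ^ n) μ) (n : ℕ) :
    ∫ y, y ^ n ∂symmetrizedSqrt μ = if Even n then ∫ x, x ^ (n / 2) ∂μ else 0 := by
  have hs := integrable_sqrt_pow hμ hint n
  have hcont : Continuous fun y : ℝ => y ^ n := continuous_pow n
  have hneg : (fun x : ℝ => (-Real.sqrt x) ^ n) = fun x => (-1) ^ n * Real.sqrt x ^ n := by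
    ext x
    rw [neg_pow]
  have i1 : Integrable (fun y : ℝ => y ^ n) (μ.map Real.sqrt) :=
    (integrable_map_measure hcont.aestronglyMeasurable
      Real.continuous_sqrt.measurable.aemeasurable).2 hs
  have i2 : Integrable (fun y : ℝ => y ^ n) (μ.map fun x => -Real.sqrt x) := by
    refine (integrable_map_measure hcont.aestronglyMeasurable
      measurable_neg_sqrt.aemeasurable).2 ?_
    have : ((fun y : ℝ => y ^ n) ∘ fun x => -Real.sqrt x) =
      fun x => (-1) ^ n * Real.sqrt x ^ n := hneg
    rw [this]
    exact hs.const_mul _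
  rw [symmetrizedSqrt, integral_smul_measure, integral_add_measure i1 i2,
    integral_map Real.continuous_sqrt.measurable.aemeasurable hcont.aestronglyMeasurable,
    integral_map measurable_neg_sqrt.aemeasurable hcont.aestronglyMeasurable, hneg,
    integral_const_mul]
  split_ifs with h
  · obtain ⟨k, rfl⟩ := h
    have e1 : ∫ x, Real.sqrt x ^ (k + k) ∂μ = ∫ x, x ^ ((k + k) / 2) ∂μ := by
      refine integral_congr_ae ?_
      filter_upwards [ae_nonneg_iff_measure_Iio.2 hμ] with x hx
      rw [← two_mul, pow_mul, Real.sq_sqrt hx, Nat.mul_div_cancel_left _ two_pos]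
    rw [e1, Even.neg_one_pow ⟨k, rfl⟩]
    simp only [ENNReal.toReal_inv, ENNReal.toReal_ofNat, smul_eq_mul]
    ring
  · rw [(Nat.not_even_iff_odd.1 h).neg_one_pow]
    simp

/-- Growth `(2n)!` is too fast to force exponential moments of `μ` itself. For the symmetrised
square root, however, the `n`-th moment of `μ` is the moment of order `2n`, and the `cosh` series
integrates to a geometric series of ratio `s²C`. -/
theorem lintegral_exp_abs_symmetrizedSqrt_lt_top {μ : Measure ℝ} [IsProbabilityMeasure μ]
    (hμ : μ (Set.Iio 0) = 0) (hint : ∀ n : ℕ, 1 ≤ n → Integrable (fun t : ℝ => t ^ n) μ)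
    {A C : ℝ} (hC : 0 ≤ C)
    (hbd : ∀ n : ℕ, ∫ t, t ^ n ∂μ ≤ A * C ^ n * (2 * n).factorial) {s : ℝ} (hs : s ^ 2 * C < 1) :
    ∫⁻ y, ENNReal.ofReal (Real.exp (s * y)) ∂symmetrizedSqrt μ < ∞ := by
  have h0 := ae_nonneg_iff_measure_Iio.2 hμ
  have hexp : Measurable fun y : ℝ => ENNReal.ofReal (Real.exp (s * y)) :=
    ENNReal.measurable_ofReal.comp (by fun_prop)
  have hA : 0 ≤ A := by
    have := hbd 0
    simp at this
    linarith
  have hint' : ∀ n : ℕ, Integrable (fun t : ℝ => t ^ n) μ := fun n => by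
    rcases Nat.eq_zero_or_pos n with rfl | hn
    · simp
    · exact hint n hn
  have hcosh : ∫⁻ x, ENNReal.ofReal (Real.cosh (s * Real.sqrt x)) ∂μ < ∞ := by
    have hx : ∀ᵐ x ∂μ, ENNReal.ofReal (Real.cosh (s * Real.sqrt x)) =
        ∑' n : ℕ, ENNReal.ofReal (s ^ (2 * n) / (2 * n).factorial * x ^ n) := by
      filter_upwards [h0] with x hx
      rw [Real.cosh_eq_tsum, ENNReal.ofReal_tsum_of_nonneg]
      · refine tsum_congr fun n => ?_
        rw [mul_pow, pow_mul (Real.sqrt x), Real.sq_sqrt hx]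
        congr 1
        ring
      · intro n
        rw [pow_mul]
        positivity
      · exact (Real.hasSum_cosh _).summable
    rw [lintegral_congr_ae hx, lintegral_tsum fun n => by fun_prop]
    have hterm : ∀ n : ℕ, ∫⁻ x, ENNReal.ofReal (s ^ (2 * n) / (2 * n).factorial * x ^ n) ∂μ ≤
        ENNReal.ofReal (A * (s ^ 2 * C) ^ n) := by
      intro n
      have hf : (0 : ℝ) < (2 * n).factorial := by exact_mod_cast Nat.factorial_pos _
      rw [← ofReal_integral_eq_lintegral_ofReal ((hint' n).const_mul _), integral_const_mul]
      · refine ENNReal.ofReal_le_ofReal ?_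
        have hs2 : 0 ≤ s ^ (2 * n) := by rw [pow_mul]; positivity
        calc s ^ (2 * n) / (2 * n).factorial * ∫ x, x ^ n ∂μ
            ≤ s ^ (2 * n) / (2 * n).factorial * (A * C ^ n * (2 * n).factorial) := by
              have := hbd n
              gcongr
          _ = A * (s ^ 2 * C) ^ n := by
              rw [mul_pow, ← pow_mul]
              field_simp
      · filter_upwards [h0] with x hx
        rw [pow_mul]
        positivity
    refine (ENNReal.tsum_le_tsum hterm).trans_lt ?_
    rw [← ENNReal.ofReal_tsum_of_nonneg]
    · exact ENNReal.ofReal_lt_top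
    · intro n
      positivity
    · exact (summable_geometric_of_lt_one (by positivity) hs).mul_left A
  have hcoshm : Measurable fun x : ℝ => ENNReal.ofReal (Real.cosh (s * Real.sqrt x)) :=
    ENNReal.measurable_ofReal.comp
      (Real.continuous_cosh.comp (continuous_const.mul Real.continuous_sqrt)).measurable
  have hle : ∀ y, Real.exp y ≤ 2 * Real.cosh y := fun y => by
    rw [Real.cosh_eq]
    have := Real.exp_pos (-y)
    linarith
  have hfin : ∀ e : ℝ, Real.cosh (s * e) = Real.cosh (s * |e|) := fun e => by
    rw [← Real.cosh_abs (s * e), ← Real.cosh_abs (s * |e|), abs_mul, abs_mul, abs_abs]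
  have key : ∀ g : ℝ → ℝ, Measurable g → (∀ x, |g x| = Real.sqrt x) →
      ∫⁻ y, ENNReal.ofReal (Real.exp (s * y)) ∂(μ.map g) < ∞ := by
    intro g hg hgabs
    rw [lintegral_map hexp hg]
    calc _ ≤ ∫⁻ x, 2 * ENNReal.ofReal (Real.cosh (s * Real.sqrt x)) ∂μ := by
          refine lintegral_mono fun x => ?_
          rw [show (2 : ℝ≥0∞) = ENNReal.ofReal 2 by simp, ← ENNReal.ofReal_mul two_pos.le]
          refine ENNReal.ofReal_le_ofReal ((hle _).trans (le_of_eq ?_))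
          rw [hfin, hgabs]
      _ < ∞ := by
          rw [lintegral_const_mul _ hcoshm]
          exact ENNReal.mul_lt_top ENNReal.ofNat_lt_top hcosh
  rw [symmetrizedSqrt, lintegral_smul_measure, lintegral_add_measure, smul_eq_mul]
  refine ENNReal.mul_lt_top (by simp) (ENNReal.add_lt_top.2 ⟨?_, ?_⟩)
  · exact key _ Real.continuous_sqrt.measurable fun x => abs_of_nonneg (Real.sqrt_nonneg x)
  · exact key _ measurable_neg_sqrt fun x => by rw [abs_neg, abs_of_nonneg (Real.sqrt_nonneg x)]

theorem zero_mem_interior_integrableExpSet_symmetrizedSqrt {μ : Measure ℝ} [IsProbabilityMeasure μ]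
    (hμ : μ (Set.Iio 0) = 0) (hint : ∀ n : ℕ, 1 ≤ n → Integrable (fun t : ℝ => t ^ n) μ)
    {A C : ℝ} (hC : 0 ≤ C)
    (hbd : ∀ n : ℕ, ∫ t, t ^ n ∂μ ≤ A * C ^ n * (2 * n).factorial) :
    0 ∈ interior (ProbabilityTheory.integrableExpSet id (symmetrizedSqrt μ)) := by
  rw [mem_interior_iff_mem_nhds]
  have hcont : Tendsto (fun s : ℝ => s ^ 2 * C) (𝓝 0) (𝓝 0) := by
    have : Continuous fun s : ℝ => s ^ 2 * C := by fun_prop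
    simpa using this.tendsto 0
  filter_upwards [hcont.eventually_lt_const zero_lt_one] with s hs
  refine ⟨Continuous.aestronglyMeasurable (by fun_prop), ?_⟩
  rw [hasFiniteIntegral_iff_ofReal (Eventually.of_forall fun y => (Real.exp_pos _).le)]
  exact lintegral_exp_abs_symmetrizedSqrt_lt_top hμ hint hC hbd hs

/-- A probability measure on `[0, ∞)` whose `n`-th moment is `O(Cⁿ (2n)!)` is determined by its
moments. -/
theorem ext_of_moments_of_le_factorial {μ₁ μ₂ : Measure ℝ} [IsProbabilityMeasure μ₁]
    [IsProbabilityMeasure μ₂] (h₁ : μ₁ (Set.Iio 0) = 0) (h₂ : μ₂ (Set.Iio 0) = 0)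
    (hi₁ : ∀ n : ℕ, 1 ≤ n → Integrable (fun t : ℝ => t ^ n) μ₁)
    (hi₂ : ∀ n : ℕ, 1 ≤ n → Integrable (fun t : ℝ => t ^ n) μ₂)
    {A C : ℝ} (hA : 1 ≤ A) (hC : 0 ≤ C)
    (hbd : ∀ n : ℕ, 1 ≤ n → ∫ t, t ^ n ∂μ₁ ≤ A * C ^ n * (2 * n).factorial)
    (hm : ∀ n : ℕ, 1 ≤ n → ∫ t, t ^ n ∂μ₁ = ∫ t, t ^ n ∂μ₂) : μ₁ = μ₂ := by
  have hm' : ∀ n : ℕ, ∫ t, t ^ n ∂μ₁ = ∫ t, t ^ n ∂μ₂ := fun n => by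
    rcases Nat.eq_zero_or_pos n with rfl | hn
    · simp
    · exact hm n hn
  have hbd' : ∀ n : ℕ, ∫ t, t ^ n ∂μ₁ ≤ A * C ^ n * (2 * n).factorial := fun n => by
    rcases Nat.eq_zero_or_pos n with rfl | hn
    · simpa using hA
    · exact hbd n hn
  -- Odd moments of the symmetrised laws vanish and even ones are the given moments, so these laws
  -- coincide; squaring then recovers `μ₁` and `μ₂`.
  have hsym : symmetrizedSqrt μ₁ = symmetrizedSqrt μ₂ := by
    refine ext_of_moments
      (zero_mem_interior_integrableExpSet_symmetrizedSqrt h₁ hi₁ hC hbd')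
      (zero_mem_interior_integrableExpSet_symmetrizedSqrt h₂ hi₂ hC
        fun n => (hm' n).symm.trans_le (hbd' n)) fun n => ?_
    rw [integral_pow_symmetrizedSqrt h₁ hi₁, integral_pow_symmetrizedSqrt h₂ hi₂, hm']
  rw [← map_sq_symmetrizedSqrt h₁, ← map_sq_symmetrizedSqrt h₂, hsym]

/-! ### Growth of the limit moments -/

/-- Labelling the blocks injectively by `Fin n` turns a partition into a self-map of `Fin n` whose
fibres recover it. -/
theorem card_finpartition_le (n : ℕ) :
    Fintype.card (Finpartition (Finset.univ : Finset (Fin n))) ≤ n ^ n := by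
  have hemb : ∀ ρ : Finpartition (Finset.univ : Finset (Fin n)), Nonempty (ρ.parts ↪ Fin n) :=
    fun ρ => Function.Embedding.nonempty_of_card_le
      (by simpa using Fintype.card_le_of_surjective _ (blockOf_surjective ρ))
  let e := fun ρ => (hemb ρ).some
  have hinj : Function.Injective fun ρ : Finpartition (Finset.univ : Finset (Fin n)) =>
      fun k => e ρ (blockOf ρ k) := by
    intro ρ ρ' h
    have := (bijective_comp_blockOf n n).1 (a₁ := ⟨ρ, e ρ⟩) (a₂ := ⟨ρ', e ρ'⟩) h
    exact (Sigma.mk.inj this).1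
  simpa using Fintype.card_le_of_injective _ hinj

/-- One term of the exponential series, `x^{2n}/(2n)! ≤ e^x` at `x = n + 1`, together with `n + 1 ≤
e^n` for the odd factor. -/
theorem natCast_succ_pow_le (n : ℕ) :
    ((n : ℝ) + 1) ^ (2 * n + 1) ≤ Real.exp 1 * (Real.exp 2) ^ n * (2 * n).factorial := by
  have h1 := Real.pow_div_factorial_le_exp ((n : ℝ) + 1) (by positivity) (2 * n)
  have hf : (0 : ℝ) < (2 * n).factorial := by exact_mod_cast Nat.factorial_pos _
  rw [div_le_iff₀ hf] at h1
  have h2 := Real.add_one_le_exp (n : ℝ)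
  calc ((n : ℝ) + 1) ^ (2 * n + 1) = ((n : ℝ) + 1) ^ (2 * n) * ((n : ℝ) + 1) := pow_succ _ _
    _ ≤ (Real.exp ((n : ℝ) + 1) * (2 * n).factorial) * Real.exp n := by gcongr
    _ = _ := by
      rw [← Real.exp_nat_mul, mul_right_comm, ← Real.exp_add, ← Real.exp_add]
      congr 2
      ring

/-- The count `n^n` of partitions and the `n`-th power in the coefficient bound combine to
`(n+1)^{2n+1}`, of order `(2n)!` up to a geometric factor. The maximum with `1` allows the exponent
`|ρ| - 1` to be raised to `n`. -/
theorem limitMoment_le {ν : Measure ℝ} {M : ℝ≥0} {c : ℝ} (hc : 0 ≤ c) {n : ℕ}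
    (hK : ∀ ρ : Finpartition (Finset.univ : Finset (Fin n)),
      |expansionCoeff ν ρ| ≤ n * (M * (2 * Real.pi * (1 + n))) ^ (ρ.parts.card - 1)) :
    limitMoment ν c n ≤ Real.exp 1 *
      (max 1 (M * (2 * Real.pi) * c) * Real.exp 2) ^ n * (2 * n).factorial := by
  set D : ℝ := max 1 (M * (2 * Real.pi) * c) with hD
  have hD1 : 1 ≤ D := le_max_left _ _
  have hpi := Real.pi_pos
  have hn0 : (0 : ℝ) ≤ n := Nat.cast_nonneg n
  have hterm : ∀ ρ : Finpartition (Finset.univ : Finset (Fin n)),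
      expansionCoeff ν ρ * c ^ (ρ.parts.card - 1) ≤ n * (D * ((n : ℝ) + 1)) ^ n := by
    intro ρ
    have hcard : ρ.parts.card - 1 ≤ n := by
      have h : ρ.parts.card ≤ n := by
        simpa using Fintype.card_le_of_surjective _ (blockOf_surjective ρ)
      omega
    calc expansionCoeff ν ρ * c ^ (ρ.parts.card - 1)
        ≤ (n * (M * (2 * Real.pi * (1 + n))) ^ (ρ.parts.card - 1)) * c ^ (ρ.parts.card - 1) := by
          gcongr
          exact (le_abs_self _).trans (hK ρ)
      _ = n * (M * (2 * Real.pi) * c * ((n : ℝ) + 1)) ^ (ρ.parts.card - 1) := by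
          rw [mul_assoc, ← mul_pow]
          congr 2
          ring
      _ ≤ n * (D * ((n : ℝ) + 1)) ^ (ρ.parts.card - 1) := by
          gcongr
          exact le_max_right _ _
      _ ≤ n * (D * ((n : ℝ) + 1)) ^ n := by
          gcongr
          nlinarith
  calc limitMoment ν c n
      ≤ ∑ _ρ : Finpartition (Finset.univ : Finset (Fin n)), n * (D * ((n : ℝ) + 1)) ^ n :=
        Finset.sum_le_sum fun ρ _ => hterm ρ
    _ = (Fintype.card (Finpartition (Finset.univ : Finset (Fin n))) : ℝ) *
          (n * (D * ((n : ℝ) + 1)) ^ n) := by simp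
    _ ≤ ((n : ℝ) + 1) ^ n * (((n : ℝ) + 1) * (D * ((n : ℝ) + 1)) ^ n) := by
        gcongr
        · calc (Fintype.card (Finpartition (Finset.univ : Finset (Fin n))) : ℝ) ≤ (n : ℝ) ^ n := by
                exact_mod_cast card_finpartition_le n
            _ ≤ _ := by
                gcongr
                linarith
        · linarith
    _ = D ^ n * ((n : ℝ) + 1) ^ (2 * n + 1) := by
        rw [mul_pow]
        ring
    _ ≤ D ^ n * (Real.exp 1 * (Real.exp 2) ^ n * (2 * n).factorial) := by
        gcongr
        exact natCast_succ_pow_le n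
    _ = _ := by ring

/-! ### Weak convergence -/

/-- Stated along any filter finer than `atTop`, so that it applies to cluster points through
ultrafilters. -/
theorem hasLimitMoments_of_tendsto {ν : Measure ℝ} [IsProbabilityMeasure ν] {c : ℝ} {N L : ℕ → ℕ}
    (hL : ∀ j, 0 < L j) (hN : Tendsto N atTop atTop)
    (hmom : ∀ n : ℕ, 1 ≤ n →
      Tendsto (fun j => expectedMoment ν (N j) (L j) n) atTop (𝓝 (limitMoment ν c n : ℂ)))
    {l : Filter ℕ} [l.NeBot] (hl : l ≤ atTop) {μ : ProbabilityMeasure ℝ}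
    (hμ : Tendsto (fun j => averagedLaw ν (N j) (L j) (hL j)) l (𝓝 μ)) :
    HasLimitMoments ν c μ := by
  have hpos : ∀ᶠ j in l, (averagedLaw ν (N j) (L j) (hL j) : Measure ℝ) (Set.Iio 0) = 0 :=
    Eventually.of_forall fun j => averagedMeasure_Iio_zero ν (N j) (hL j)
  have hNl := hl (hN.eventually_gt_atTop 0)
  refine ⟨measure_Iio_zero_of_tendsto hμ hpos, ?_⟩
  refine moments_of_tendsto hμ hpos (fun n hn => ?_) fun n hn => ?_
  · filter_upwards [hNl] with j hj using integrable_pow_averagedMeasure ν hj (hL j) hn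
  · have h := ((Complex.continuous_re.tendsto _).comp (hmom n hn)).mono_left hl
    rw [Complex.ofReal_re] at h
    refine h.congr' ?_
    filter_upwards [hNl] with j hj
    exact (integral_pow_averagedMeasure ν hj (hL j) hn).symm

theorem exists_isCompact_eventually_averagedLaw_mem {ν : Measure ℝ} [IsProbabilityMeasure ν]
    {c : ℝ} {N L : ℕ → ℕ} (hL : ∀ j, 0 < L j) (hN : Tendsto N atTop atTop)
    (hmom : Tendsto (fun j => expectedMoment ν (N j) (L j) 1) atTop
      (𝓝 (limitMoment ν c 1 : ℂ))) :
    ∃ s : Set (ProbabilityMeasure ℝ), IsCompact s ∧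
      ∀ᶠ j in atTop, averagedLaw ν (N j) (L j) (hL j) ∈ s := by
  obtain ⟨s, hs, hmem⟩ := exists_isCompact_of_mean_le (limitMoment ν c 1 + 1)
  refine ⟨s, hs, ?_⟩
  have h := (Complex.continuous_re.tendsto _).comp hmom
  rw [Complex.ofReal_re] at h
  filter_upwards [hN.eventually_gt_atTop 0, h.eventually_le_const (lt_add_one _)] with j hj hle
  have hi := integrable_pow_averagedMeasure ν hj (hL j) one_pos
  have hm := integral_pow_averagedMeasure ν hj (hL j) one_pos
  simp only [pow_one] at hi hm
  exact hmem _ (averagedMeasure_Iio_zero ν (N j) (hL j)) hi (hm.le.trans hle)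

end RandomVandermonde

/-! ### Assembly: coefficients, determinacy, existence and weak convergence. -/

theorem mainTheorem2 (ν : Measure ℝ) [IsProbabilityMeasure ν] (p : ℝ → ℝ)
    (hp_cont : ContinuousOn p (Set.Icc (-Real.pi) Real.pi))
    (hp_nonneg : ∀ x ∈ Set.Icc (-Real.pi) Real.pi, 0 ≤ p x)
    (hν : ν = (volume.restrict (Set.Icc (-Real.pi) Real.pi)).withDensity
      fun x => ENNReal.ofReal (p x)) :
    (∀ (n : ℕ), 1 ≤ n → ∀ ρ : Finpartition (Finset.univ : Finset (Fin n)),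
      Tendsto (fun N : ℕ => RandomVandermonde.expansionCoeffN ν ρ N) atTop
        (𝓝 (RandomVandermonde.expansionCoeff ν ρ : ℂ))) ∧
    ∀ c : ℝ, 0 ≤ c →
      ∃ μ : ProbabilityMeasure ℝ,
        RandomVandermonde.HasLimitMoments ν c μ ∧
        (∀ μ' : ProbabilityMeasure ℝ, RandomVandermonde.HasLimitMoments ν c μ' → μ' = μ) ∧
        ∀ (N L : ℕ → ℕ) (hL : ∀ j, 0 < L j),
          Tendsto N atTop atTop →
          Tendsto (fun j => (L j : ℝ) / (N j : ℝ)) atTop (𝓝 c) →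
          (∀ n : ℕ, 1 ≤ n →
            Tendsto (fun j => RandomVandermonde.expectedMoment ν (N j) (L j) n) atTop
              (𝓝 (RandomVandermonde.limitMoment ν c n : ℂ))) ∧
          Tendsto (fun j => RandomVandermonde.averagedLaw ν (N j) (L j) (hL j)) atTop (𝓝 μ) := by
  have hP := RandomVandermonde.measurable_periodicExtension hp_cont
  obtain ⟨M, hPM⟩ := RandomVandermonde.exists_abs_periodicExtension_le hp_cont
  have hper := RandomVandermonde.periodicExtension_periodic p
  have hfour := RandomVandermonde.phaseFourier_eq_densityFourier hp_cont hp_nonneg hν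
  have hcont : ∀ᵐ x ∂ν, ContinuousAt (RandomVandermonde.periodicExtension p) x := by
    filter_upwards [RandomVandermonde.ae_mem_Ioo hν] with x hx
    exact RandomVandermonde.continuousAt_periodicExtension hp_cont hx
  have hK : ∀ (n : ℕ), 1 ≤ n → ∀ ρ : Finpartition (Finset.univ : Finset (Fin n)),
      Tendsto (fun N : ℕ => RandomVandermonde.expansionCoeffN ν ρ N) atTop
        (𝓝 (RandomVandermonde.expansionCoeff ν ρ : ℂ)) := fun n hn ρ =>
    RandomVandermonde.tendsto_expansionCoeffN hP hPM hper hfour hcont hn ρ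
  refine ⟨hK, fun c hc => ?_⟩
  have hmom : ∀ (N L : ℕ → ℕ), (∀ j, 0 < L j) → Tendsto N atTop atTop →
      Tendsto (fun j => (L j : ℝ) / (N j : ℝ)) atTop (𝓝 c) → ∀ n : ℕ, 1 ≤ n →
      Tendsto (fun j => RandomVandermonde.expectedMoment ν (N j) (L j) n) atTop
        (𝓝 (RandomVandermonde.limitMoment ν c n : ℂ)) := fun N L hL hN hlim n hn =>
    RandomVandermonde.tendsto_expectedMoment ν hn (hK n hn) hL hN hlim
  have huniq : ∀ μ₁ μ₂ : ProbabilityMeasure ℝ, RandomVandermonde.HasLimitMoments ν c μ₁ →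
      RandomVandermonde.HasLimitMoments ν c μ₂ → μ₁ = μ₂ := by
    intro μ₁ μ₂ h₁ h₂
    have : IsProbabilityMeasure μ₁.1 := μ₁.2
    have : IsProbabilityMeasure μ₂.1 := μ₂.2
    refine Subtype.ext (RandomVandermonde.ext_of_moments_of_le_factorial h₁.1 h₂.1
      (fun n hn => (h₁.2 n hn).1) (fun n hn => (h₂.2 n hn).1)
      (A := Real.exp 1) (C := max 1 (M * (2 * Real.pi) * c) * Real.exp 2)
      (Real.one_le_exp zero_le_one) (by positivity) (fun n hn => ?_) fun n hn => ?_)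
    · exact (h₁.2 n hn).2.trans_le (RandomVandermonde.limitMoment_le hc fun ρ =>
        RandomVandermonde.abs_expansionCoeff_le hP hPM hper hfour hcont hn ρ)
    · exact (h₁.2 n hn).2.trans (h₂.2 n hn).2.symm
  obtain ⟨μ, hμ⟩ : ∃ μ : ProbabilityMeasure ℝ, RandomVandermonde.HasLimitMoments ν c μ := by
    -- One admissible sequence suffices for existence: `N = j + 1` and `L = ⌊c (j + 1)⌋ + 1`. The
    -- added `1` keeps `L` positive, also for `c = 0`, and does not affect the ratio in the limit.
    have hL : ∀ j : ℕ, 0 < ⌊c * ((j : ℝ) + 1)⌋₊ + 1 := fun j => Nat.succ_pos _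
    have hN : Tendsto (fun j : ℕ => j + 1) atTop atTop := tendsto_add_atTop_nat 1
    have hNR : Tendsto (fun j : ℕ => (j : ℝ) + 1) atTop atTop :=
      tendsto_atTop_add_const_right _ _ tendsto_natCast_atTop_atTop
    have hlim : Tendsto (fun j : ℕ => ((⌊c * ((j : ℝ) + 1)⌋₊ + 1 : ℕ) : ℝ) / ((j + 1 : ℕ) : ℝ))
        atTop (𝓝 c) := by
      have h1 := (tendsto_nat_floor_mul_div_atTop hc).comp hNR
      have h2 := h1.add (tendsto_const_nhds (x := (1 : ℝ)).div_atTop hNR)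
      rw [add_zero] at h2
      refine h2.congr fun j => ?_
      push_cast
      simp only [Function.comp_apply]
      rw [add_div]
    have hm := hmom _ _ hL hN hlim
    obtain ⟨s, hs, hmem⟩ := RandomVandermonde.exists_isCompact_eventually_averagedLaw_mem hL hN
      (hm 1 le_rfl)
    obtain ⟨μ, -, hclus⟩ := hs.exists_mapClusterPt (le_principal_iff.2 hmem)
    obtain ⟨U, hU, hUμ⟩ := mapClusterPt_iff_ultrafilter.1 hclus
    exact ⟨μ, RandomVandermonde.hasLimitMoments_of_tendsto hL hN hm hU hUμ⟩
  refine ⟨μ, hμ, fun μ' hμ' => huniq μ' μ hμ' hμ, fun N L hL hN hlim => ?_⟩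
  have hm := hmom N L hL hN hlim
  refine ⟨hm, ?_⟩
  obtain ⟨s, hs, hmem⟩ := RandomVandermonde.exists_isCompact_eventually_averagedLaw_mem hL hN
    (hm 1 le_rfl)
  -- In a compact set a single cluster point forces convergence; determinacy identifies every
  -- cluster point with `μ`.
  refine hs.tendsto_nhds_of_unique_mapClusterPt hmem fun μ' _ hclus => ?_
  obtain ⟨U, hU, hUμ⟩ := mapClusterPt_iff_ultrafilter.1 hclus
  exact huniq _ _ (RandomVandermonde.hasLimitMoments_of_tendsto hL hN hm hU hUμ) hμ
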